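/- **Setting.** Let $0<p<1$ and $N=\frac1{1-p}$. Consider the resonant system $i\,\dot\alpha_j=\sum_{S\ge j}\sum_{k=0}^{S}C^S_{jk}\,\bar\alpha_{S-j}\alpha_k\alpha_{S-k}$ $(j\ge 0)$, with centred Gaussian real couplings of covariance $$\langle C^S_{jk}C^{S'}_{j'k'}\rangle=\tfrac{\delta_{SS'}}8\bigl(\delta_{jj'}\delta_{kk'}+\delta_{j,S-j'}\delta_{kk'}+\delta_{jj'}\delta_{k,S-k'}+\delta_{j,S-j'}\delta_{k,S-k'}+\delta_{jk'}\delta_{kj'}+\delta_{j,S-k'}\delta_{kj'}+\delta_{jk'}\delta_{k,S-j'}+\delta_{j,S-k'}\delta_{k,S-j'}\bigr)$$ and centred complex Gaussian initial data with $\langle\alpha_j(0)\bar\alpha_{j'}(0)\rangle=\frac{\delta_{jj'}}N p^{j}$ and $\langle\alpha_j(0)\alpha_{j'}(0)\rangle=0$. The time-power series of the averaged Sobolev norm $\sum_r r^\gamma\langle|\alpha_r(t)|^2\rangle$ is a sum over the following graphs. **Graphs.** A graph $G=(U,w,w')$ of order $n$ consists of: * a plane tree $U$ with a bivalent root, whose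 two root edges are one out-going (tree side) and one in-going (anti-tree side), and $n$ true vertices. Each true vertex $v$ has a parent-edge $e_1$ and ordered children-edges $e_2,e_3,e_4$, where $e_2$ has the same orientation (in-going or out-going at $v$) as $e_1$ and $e_3,e_4$ have the opposite one. The true vertices are labelled $1,\dots,n$, increasingly from parent to child. The tree has $n+1$ out-going leaves and $n+1$ in-going anti-leaves; * a bijection $w$ from the leaves to the anti-leaves, which joins them into $n+1$ dashed edges (the edges of $U$ that do not end at a leaf or an anti-leaf are called solid); * a perfect matching $w'$ of the true vertices by wavy edges, together with a choice, for each wavy edge, of one of the eight terms (propagators) of the covariance above. At a true vertex $v$ the half-edges on $e_1,e_2,e_3,e_4$ carry the momenta $j_v,\ S_v-j_v,\ k_v,\ S_v-k_v$, with $0\le j_v,k_v\le S_v$ integers. The amplitude at root momentum $r$ is $$\mathcal A_r(G)=\frac1{N^n}\sum\ \prod_{e\text{ dashed}}p^{j_e},$$ where the sum is over all $(S_v,j_v,k_v)_v$ such that the two halves of every edge carry the same momentum $j_e$, the root edges carry momentum $r$, and the Kronecker deltas of the chosen propagators are satisfied. The sign $\epsilon(U)=\pm1$ is the product over the true vertices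 of $-i$ (parent-edge in-going) or $+i$ (parent-edge out-going). **Melonic graphs.** An elementary two-point melon consists of two true vertices $v,v'$ joined by a wavy edge and by three further (dashed or solid) edges, with the leading propagator on the wavy edge, i.e. the one whose momentum identifications are already implied by these edges: each of the three edges joins two half-edges identified by the propagator, and the propagator also identifies the two remaining external half-edges. A melonic reduction removes $v,v'$ and replaces the two external edges by a single edge. A graph is melonic if a sequence of melonic reductions takes it to the graph of order $0$. Set $$G_2^{melo}(r,t)=\sum_{n\text{ even}}\frac{t^n}{n!}\,8^{-n/2}\sum_{G\text{ melonic of order }n}\epsilon(U)\,\mathcal A_r(G),\qquad S^{melo}_\gamma(t)=\sum_{r\ge0}\frac{r^\gamma}{N}\,G_2^{melo}(r,t)=\sum_{n\text{ even}}s^{melo}_{\gamma,n}\,t^n .$$ **Theorem.** For every real $\gamma>1$ and every $p_0\in(0,1)$ there is $\delta>0$, depending only on $\gamma$ and $p_0$, such that for every $p\in[p_0,1)$ (that is, for all $N\ge N_0=\frac1{1-p_0}$) the momentum sums defining the amplitudes of melonic graphs converge, the double series over $r$ and $n$ defining $S^{melo}_\gamma(t)$ converges absolutely for $t\in[0,\delta]$,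 and $t\mapsto S^{melo}_\gamma(t)$ is strictly increasing on $[0,\delta]$. -/

import Mathlib

/-!
The melonic approximation to the averaged Sobolev norms of the random resonant system
`i dα_j/dt = ∑_{S ≥ j} ∑_{k ≤ S} C^S_{jk} conj(α_{S-j}) α_k α_{S-k}`,
with Gaussian couplings `C` and Gaussian initial data of covariance
`⟨α_j(0) conj(α_{j'}(0))⟩ = δ_{jj'} p^j / N`, `N = 1/(1-p)`, `0 < p < 1`.
-/

namespace MelonicTurbulence

/-- The half-edges of a graph with a bivalent root and `n` four-valent vertices.
`Sum.inl true` and `Sum.inl false` are the two half-edges at the root: the out-going one, which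
carries the tree (the expansion of `α_r(t)`), and the in-going one, which carries the anti-tree
(the expansion of the conjugate of `α_r(t)`).
`Sum.inr (v, 0)` is the half-edge of `v` on its parent-edge `e₁(v)`; `Sum.inr (v, 1)`,
`Sum.inr (v, 2)`, `Sum.inr (v, 3)` are those on its children-edges `e₂(v), e₃(v), e₄(v)`. -/
abbrev HalfEdge (n : ℕ) : Type := Bool ⊕ (Fin n × Fin 4)

/-- The half-edge belongs to the parent-edge of a true vertex. -/
def HalfEdge.IsParent {n : ℕ} : HalfEdge n → Prop
  | Sum.inl _ => False
  | Sum.inr (_, c) => c = 0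

/-- `x` is a place where the vertex `v` may hang in a heap-ordered tree: a half-edge at the root,
or a child half-edge of a vertex with a smaller label. -/
def HalfEdge.IsSlotFor {n : ℕ} (x : HalfEdge n) (v : Fin n) : Prop :=
  match x with
  | Sum.inl _ => True
  | Sum.inr (u, c) => c ≠ 0 ∧ u < v

/-- Whether a half-edge is out-going, when `ingoing v` records whether the parent-edge of `v` is
in-going at `v`.  The child-edge `e₂(v)` has the orientation of the parent-edge, `e₃(v)` and
`e₄(v)` have the opposite one. -/
def HalfEdge.isOut {n : ℕ} (ingoing : Fin n → Bool) : HalfEdge n → Bool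
  | Sum.inl b => b
  | Sum.inr (v, c) => if c = 0 ∨ c = 1 then !(ingoing v) else ingoing v

/-- The exchange of `j` with `S - j` and of `k` with `S - k` among the four momenta
`j, S - j, k, S - k` of a vertex. -/
def opp : Fin 4 → Fin 4 := ![1, 0, 3, 2]

/-- A Feynman graph `G = (U, w, w')` of order `n`: a heap-ordered ternary 2-rooted tree `U` with
`n` true vertices (labelled by `Fin n` in the heap-order), a pairing `w` of the leaves with the
anti-leaves of `U`, and a Wick contraction `w'` of the couplings.

`U` and `w` are recorded together by the map `edge` that sends each half-edge to the other half of
its edge: the solid edges, between `(v, 0)` and a child half-edge of the parent of `v`, together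
with the root edges to true vertices give `U`; the child (or root) half-edges which do not carry a
vertex are the leaves (out-going) and the anti-leaves (in-going) of `U`, and `edge` pairs them into
the dashed edges of `w`.  The orientation `ingoing` is determined by `U`: every edge goes from an
out-going half-edge to an in-going one.

`w'` is given by a perfect matching `wavy` of the true vertices, together with one of the eight
propagators for each matched pair.  The eight terms of the covariance
`(δ_{SS'}/8)(δ_{jj'}δ_{kk'} + δ_{j,S-j'}δ_{kk'} + δ_{jj'}δ_{k,S-k'} + δ_{j,S-j'}δ_{k,S-k'}
  + δ_{jk'}δ_{kj'} + δ_{j,S-k'}δ_{kj'} + δ_{jk'}δ_{k,S-j'} + δ_{j,S-k'}δ_{k,S-j'})`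
are the eight bijections `prop v` from the momenta `j, S - j, k, S - k` of `v` to the momenta of
`wavy v` that respect the two pairs `{j, S - j}` and `{k, S - k}`. -/
@[ext]
structure FeynmanGraph (n : ℕ) where
  /-- the other half of the edge of a half-edge -/
  edge : HalfEdge n → HalfEdge n
  /-- whether the parent-edge of a vertex is in-going at the vertex -/
  ingoing : Fin n → Bool
  /-- the other end of the wavy edge of a vertex -/
  wavy : Fin n → Fin n
  /-- the propagator on the wavy edge of `v`, as a map of the four momenta of `v` to those of
  `wavy v` -/
  prop : Fin n → Fin 4 → Fin 4
  edge_edge : ∀ h, edge (edge h) = h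
  isOut_edge : ∀ h, HalfEdge.isOut ingoing (edge h) = !(HalfEdge.isOut ingoing h)
  heap : ∀ v, (edge (Sum.inr (v, 0))).IsSlotFor v
  wavy_wavy : ∀ v, wavy (wavy v) = v
  wavy_ne : ∀ v, wavy v ≠ v
  prop_prop : ∀ v c, prop (wavy v) (prop v c) = c
  prop_opp : ∀ v c, prop v (opp c) = opp (prop v c)

noncomputable instance (n : ℕ) : Fintype (FeynmanGraph n) :=
  Fintype.ofInjective
    (β := (HalfEdge n → HalfEdge n) × (Fin n → Bool) × (Fin n → Fin n) × (Fin n → Fin 4 → Fin 4))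
    (fun G => (G.edge, G.ingoing, G.wavy, G.prop))
    (fun G H h => by
      simp only [Prod.mk.injEq] at h
      exact FeynmanGraph.ext h.1 h.2.1 h.2.2.1 h.2.2.2)

namespace FeynmanGraph

variable {n : ℕ}

/-- The sign `ε(U)`: the product of the factors `-i` (in-going parent-edge) and `+i` (out-going
parent-edge) of the true vertices.  The product is real, because `n` is even for every graph. -/
noncomputable def sign (G : FeynmanGraph n) : ℝ :=
  (∏ v : Fin n, if G.ingoing v then -Complex.I else Complex.I).re

open Classical in
/-- The leaves of `U` (one for each dashed edge): the out-going half-edges which lie on an edge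
that is not the parent-edge of any true vertex. -/
noncomputable def leaves (G : FeynmanGraph n) : Finset (HalfEdge n) :=
  Finset.univ.filter fun h =>
    HalfEdge.isOut G.ingoing h = true ∧ ¬ h.IsParent ∧ ¬ (G.edge h).IsParent

/-- The momentum of a half-edge; those at the root have momentum `r`. -/
def halfEdgeMomentum (r : ℕ) (i : Fin n → Fin 4 → ℕ) : HalfEdge n → ℕ
  | Sum.inl _ => r
  | Sum.inr (v, c) => i v c

/-- The momentum attributions allowed by the graph when the root momentum is `r`.  A choice of
`S_v` and `j_v, k_v ≤ S_v` is the same thing as a choice of the four momenta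
`i v 0 = j_v`, `i v 1 = S_v - j_v`, `i v 2 = k_v`, `i v 3 = S_v - k_v` subject to the resonance
condition `i v 0 + i v 1 = i v 2 + i v 3`. -/
structure IsMomentum (G : FeynmanGraph n) (r : ℕ) (i : Fin n → Fin 4 → ℕ) : Prop where
  /-- resonance at each true vertex -/
  resonance : ∀ v, i v 0 + i v 1 = i v 2 + i v 3
  /-- the two halves of every (solid or dashed) edge carry the same momentum -/
  edge : ∀ h, halfEdgeMomentum r i (G.edge h) = halfEdgeMomentum r i h
  /-- the identifications made by the propagator of each wavy edge -/
  wavy : ∀ v c, i (G.wavy v) (G.prop v c) = i v c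

/-- The factor `∏_e p^{j_e}` over the dashed edges. -/
noncomputable def weight (G : FeynmanGraph n) (p : ℝ) (r : ℕ) (i : Fin n → Fin 4 → ℕ) : ℝ :=
  ∏ h ∈ G.leaves, p ^ halfEdgeMomentum r i h

end FeynmanGraph

/-- `N = 1 / (1 - p)`. -/
noncomputable def modeNumber (p : ℝ) : ℝ := 1 / (1 - p)

/-- The amplitude `𝒜_r(G)`. -/
noncomputable def FeynmanGraph.amplitude {n : ℕ} (G : FeynmanGraph n) (p : ℝ) (r : ℕ) : ℝ :=
  1 / modeNumber p ^ n * ∑' i : {i : Fin n → Fin 4 → ℕ // G.IsMomentum r i}, G.weight p r i.1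

/-- The relabelling of half-edges along a relabelling of the true vertices. -/
def HalfEdge.relabel {m n : ℕ} (f : Fin m → Fin n) : HalfEdge m → HalfEdge n
  | Sum.inl b => Sum.inl b
  | Sum.inr (v, c) => Sum.inr (f v, c)

/-- `H` is obtained from `G` by a melonic reduction.  Two vertices `v` and `v' = wavy v`
form an elementary two-point melon with external half-edges `(v, a)` and `(v', prop v a)`: the other
three half-edges of `v` are joined to the other three half-edges of `v'` by edges, and the
propagator is the leading one, namely the one that identifies exactly the momenta identified by
these edges.  Then `v` and `v'` are removed and the two edges that carry the external half-edges
are replaced by a single edge; the remaining vertices keep their order.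

When `v` and `v'` are not adjacent in the tree, the heap-order and the orientation force `a = 0`
and `prop v 0 = 0`: these are the two melons of type I, with three dashed internal edges.
Otherwise say that `v` is the parent of `v'`; one internal edge is solid and `a = 0`.  If the solid
edge is `e₂(v)`, the other external half-edge is on `e₂(v')`: types II (new edge dashed) and II s
(new edge solid).  If it is `e₃(v)` or `e₄(v)`, the other external half-edge is on `e₃(v')` or
`e₄(v')`: types III (new edge dashed) and III s (new edge solid). -/
def FeynmanGraph.ReducesTo {n : ℕ} (G : FeynmanGraph (n + 2)) (H : FeynmanGraph n) : Prop :=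
  ∃ (f : Fin n ↪o Fin (n + 2)) (v : Fin (n + 2)) (a : Fin 4),
    v ∉ Set.range f ∧ G.wavy v ∉ Set.range f ∧
    (∀ c, c ≠ a → G.edge (Sum.inr (v, c)) = Sum.inr (G.wavy v, G.prop v c)) ∧
    (∀ h, (H.edge h).relabel f =
      if G.edge (h.relabel f) = Sum.inr (v, a) then
        G.edge (Sum.inr (G.wavy v, G.prop v a))
      else if G.edge (h.relabel f) = Sum.inr (G.wavy v, G.prop v a) then
        G.edge (Sum.inr (v, a))
      else G.edge (h.relabel f)) ∧
    (∀ u, H.ingoing u = G.ingoing (f u)) ∧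
    (∀ u, f (H.wavy u) = G.wavy (f u)) ∧
    (∀ u, H.prop u = G.prop (f u))

/-- A graph is melonic if a sequence of melonic reductions takes it to the trivial graph, the only
graph of order `0`. -/
inductive FeynmanGraph.IsMelonic : {n : ℕ} → FeynmanGraph n → Prop
  | trivial (G : FeynmanGraph 0) : IsMelonic G
  | step {n : ℕ} {G : FeynmanGraph (n + 2)} {H : FeynmanGraph n} :
      G.ReducesTo H → IsMelonic H → IsMelonic G

open Classical in
/-- The coefficient of `t^n` in `G₂^melo(r, t)`, for the even order `n = 2 * m`:
`(1 / n!) 8^{-n/2} ∑_{G melonic of order n} ε(U) 𝒜_r(G)`. -/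
noncomputable def melonicG2Coeff (p : ℝ) (r m : ℕ) : ℝ :=
  1 / ((2 * m).factorial : ℝ) * (1 / 8 ^ m) *
    ∑ G ∈ (Finset.univ : Finset (FeynmanGraph (2 * m))).filter (fun G => G.IsMelonic),
      G.sign * G.amplitude p r

/-- The coefficient `s^melo_{γ,n}` of `t^n` in the melonic Sobolev norm, for the even order
`n = 2 * m`. -/
noncomputable def melonicSobolevCoeff (γ p : ℝ) (m : ℕ) : ℝ :=
  ∑' r : ℕ, (r : ℝ) ^ γ / modeNumber p * melonicG2Coeff p r m

/-- The melonic Sobolev norm `S^melo_γ(t) = ∑_{n even} s^melo_{γ,n} t^n`. -/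
noncomputable def melonicSobolevNorm (γ p t : ℝ) : ℝ :=
  ∑' m : ℕ, melonicSobolevCoeff γ p m * t ^ (2 * m)

end MelonicTurbulence

/-!
The coefficient of `t ^ 2` of the melonic Sobolev norm is at least `c * N ^ γ`, while the coefficient
of `t ^ (2 * m)` is at most `A * N ^ γ * D ^ m` in absolute value, with `c`, `A`, `D` depending on
`γ` and `p₀` only.  A power series in `t ^ 2` with such coefficients converges and is strictly
increasing near `0`, on an interval that only depends on `c`, `A` and `D`
(`tsum_lt_tsum_of_linear_coeff`).

*Upper bound.*  In any graph the momenta of all edges are determined by those of the at most `n + 1`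
dashed edges, because at a true vertex the momentum of the parent-edge follows from those of the
children-edges (`IsMomentum.eq_of_leaves`), and the root momentum is at most `2 ^ n` times the sum of
the dashed momenta (`IsMomentum.root_le`).  So `∑ r ^ γ 𝒜_r(G) / N` is at most
`N ^ γ` times an exponential in `n`: there are at most `n + 1` free geometric sums, against `n + 1`
factors `1 / N`.  Melonicity is used to count graphs.  A melonic graph is drawn by a stack machine
that reads a word with one letter for each edge, in which the insertion of a melon on an edge is the
insertion of four consecutive letters (`exists_trace_insert`).  The word has `2 * n + 1` letters, of
which `n / 2` are labelled by pairs of vertices, so that there are at most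
`C ^ n * n ^ n ≤ (C * e) ^ n * n!` melonic graphs; the factor `1 / n!` in the series absorbs the
factorial.

*Lower bound.*  The melonic graphs of order two are the sixteen graphs given by one of the eight
propagators and a side of the root (`exists_eq_orderTwo`).  Their momenta are the quadruples
`(j, S - j, k, S - k)`, and after symmetrization (`four_mul_tsum_signedWeight`) their total
contribution is a sum of
`(j ^ γ + (S - j) ^ γ - k ^ γ - (S - k) ^ γ) * p ^ S * (p ^ j + p ^ (S - j) - p ^ k - p ^ (S - k))`.
The functions `x ^ γ` and `p ^ x` are both convex, so that the two differences have the same sign, the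
one that tells which of the pairs `(j, S - j)` and `(k, S - k)` is more spread; and of the order of
`N ^ 3` quadruples of size `N` contribute at least a constant times `N ^ γ` each, which the
prefactor `1 / (4 * N ^ 3)` turns into the claimed bound (`growthConstant_mul_le`).
-/

namespace MelonicTurbulence

/-! ### Words that code melonic graphs -/

/-- A labelled melon: its two vertices `v`, `v'`, the slot `a` of the external half-edge of `v`,
and the propagator read from `v` and from `v'`. -/
structure Melon (n : ℕ) where
  /-- the vertex that is met first -/
  v : Fin n
  /-- the vertex that is met last -/
  v' : Fin n
  /-- the slot of the external half-edge of `v` -/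
  a : Fin 4
  /-- the propagator, from the momenta of `v` to those of `v'` -/
  π : Fin 4 → Fin 4
  /-- the propagator, from the momenta of `v'` to those of `v` -/
  π' : Fin 4 → Fin 4

namespace Melon

variable {n : ℕ}

/-- The external half-edge of the first vertex. -/
def entry (l : Melon n) : HalfEdge n := Sum.inr (l.v, l.a)

/-- The external half-edge of the second vertex. -/
def exit (l : Melon n) : HalfEdge n := Sum.inr (l.v', l.π l.a)

/-- The three internal lines of a melon. -/
def lines (l : Melon n) : List (HalfEdge n × HalfEdge n) :=
  ((List.finRange 4).filter (· ≠ l.a)).map fun c => (Sum.inr (l.v, c), Sum.inr (l.v', l.π c))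

/-- The relabelling of the two vertices of a melon. -/
def map {m : ℕ} (f : Fin m → Fin n) (l : Melon m) : Melon n := ⟨f l.v, f l.v', l.a, l.π, l.π'⟩

theorem length_lines (l : Melon n) : l.lines.length = 3 := by
  have : ∀ a : Fin 4, ((List.finRange 4).filter (· ≠ a)).length = 3 := by decide
  simp only [lines, List.length_map, this]

theorem mem_lines {l : Melon n} {e : HalfEdge n × HalfEdge n} :
    e ∈ l.lines ↔ ∃ c, c ≠ l.a ∧ (Sum.inr (l.v, c), Sum.inr (l.v', l.π c)) = e := by
  simp [lines]

/-- A melon as a tuple. -/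
def toProd (l : Melon n) :
    (Fin n × Fin n) × Fin 4 × (Fin 4 → Fin 4) × (Fin 4 → Fin 4) :=
  ((l.v, l.v'), l.a, l.π, l.π')

theorem toProd_injective : Function.Injective (toProd (n := n)) := by
  rintro ⟨⟩ ⟨⟩ h
  simp only [toProd, Prod.mk.injEq] at h
  obtain ⟨⟨rfl, rfl⟩, rfl, rfl, rfl⟩ := h
  rfl

end Melon

variable {n : ℕ}

/-- The edges of a partially drawn melonic graph.  The list `st` holds the lines still to be drawn,
each given by its two end half-edges.  The letter `none` draws the first line as a single edge;
the letter `some l` draws the edge from the beginning of the line to the melon `l`, and puts the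
three internal lines of `l` and the rest of the line, from the other end of `l`, on the list.
Drawing stops when the word or the list is used up. -/
def trace : List (Option (Melon n)) → List (HalfEdge n × HalfEdge n) →
    List (HalfEdge n × HalfEdge n)
  | _, [] => []
  | [], _ :: _ => []
  | none :: w, e :: st => e :: trace w st
  | some l :: w, e :: st => (e.1, l.entry) :: trace w (l.lines ++ (l.exit, e.2) :: st)

theorem trace_replicate_none (L st : List (HalfEdge n × HalfEdge n)) (w : List (Option (Melon n))) :
    trace (List.replicate L.length none ++ w) (L ++ st) = L ++ trace w st := by
  induction L with
  | nil => simp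
  | cons e L ih => simp [List.replicate_succ, trace, ih]

/-- The beginning of the first line only shows in the first edge drawn. -/
theorem trace_cons_eq_cons {w : List (Option (Melon n))} {st E : List (HalfEdge n × HalfEdge n)}
    {e d : HalfEdge n × HalfEdge n} (h : trace w (e :: st) = d :: E) (x : HalfEdge n) :
    e.1 = d.1 ∧ trace w ((x, e.2) :: st) = (x, d.2) :: E := by
  match w with
  | [] => simp [trace] at h
  | none :: w =>
    simp only [trace, List.cons.injEq] at h ⊢
    obtain ⟨rfl, rfl⟩ := h
    simp
  | some l :: w =>
    simp only [trace, List.cons.injEq] at h ⊢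
    obtain ⟨rfl, rfl⟩ := h
    simp

/-- A melon can be inserted on any edge of the graph drawn by a word, by inserting the letter of
the melon and the letters of its three internal edges before the letter that draws the edge. -/
theorem exists_trace_insert (l : Melon n) (w : List (Option (Melon n))) :
    ∀ (st E₁ E₂ : List (HalfEdge n × HalfEdge n)) (d : HalfEdge n × HalfEdge n),
      trace w st = E₁ ++ d :: E₂ → ∃ w₁ w₂, w = w₁ ++ w₂ ∧
        trace (w₁ ++ some l :: (List.replicate 3 none ++ w₂)) st =
          E₁ ++ (d.1, l.entry) :: (l.lines ++ (l.exit, d.2) :: E₂) := by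
  induction w with
  | nil => intro st E₁ E₂ d h; cases st <;> simp [trace] at h
  | cons o w ih =>
    intro st E₁ E₂ d h
    obtain _ | ⟨e, st⟩ := st
    · simp [trace] at h
    obtain _ | ⟨b, E₁⟩ := E₁
    · obtain ⟨h1, h2⟩ := trace_cons_eq_cons h l.exit
      refine ⟨[], o :: w, rfl, ?_⟩
      rw [← l.length_lines]
      simp only [List.nil_append, trace, trace_replicate_none, h2, h1]
    · cases o with
      | none =>
        simp only [trace, List.cons_append, List.cons.injEq] at h
        obtain ⟨w₁, w₂, rfl, h2⟩ := ih _ _ _ _ h.2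
        refine ⟨none :: w₁, w₂, rfl, ?_⟩
        simp only [List.cons_append, trace, h2, h.1]
      | some k =>
        simp only [trace, List.cons_append, List.cons.injEq] at h
        obtain ⟨w₁, w₂, rfl, h2⟩ := ih _ _ _ _ h.2
        refine ⟨some k :: w₁, w₂, rfl, ?_⟩
        simp only [List.cons_append, trace, h2, h.1]

theorem lines_map {m : ℕ} (f : Fin m → Fin n) (l : Melon m) :
    (l.map f).lines = l.lines.map (Prod.map (HalfEdge.relabel f) (HalfEdge.relabel f)) := by
  simp only [Melon.lines, Melon.map, List.map_map]
  rfl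

theorem trace_map {m : ℕ} (f : Fin m → Fin n) (w : List (Option (Melon m))) :
    ∀ st : List (HalfEdge m × HalfEdge m),
      trace (w.map (Option.map (Melon.map f)))
          (st.map (Prod.map (HalfEdge.relabel f) (HalfEdge.relabel f))) =
        (trace w st).map (Prod.map (HalfEdge.relabel f) (HalfEdge.relabel f)) := by
  induction w with
  | nil => intro st; cases st <;> simp [trace]
  | cons o w ih =>
    intro st
    obtain _ | ⟨e, st⟩ := st
    · simp [trace]
    cases o with
    | none => simp [trace, ih]
    | some l =>
      have h := ih (l.lines ++ (l.exit, e.2) :: st)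
      simp only [List.map_append, List.map_cons, ← lines_map] at h
      simp only [List.map_cons, Option.map_some, trace]
      rw [← h]
      rfl

/-- The word `w` codes the graph `G`: it draws the edges of `G` from the line between the two
half-edges at the root, and its letters `some l` are the pairs of vertices of `G` joined by wavy
edges. -/
structure IsCode (G : FeynmanGraph n) (w : List (Option (Melon n))) : Prop where
  /-- the pairs drawn are edges of the graph -/
  edge : ∀ e ∈ trace w [(Sum.inl true, Sum.inl false)], G.edge e.1 = e.2
  /-- every half-edge is drawn -/
  cover : ∀ h, ∃ e ∈ trace w [(Sum.inl true, Sum.inl false)], h = e.1 ∨ h = e.2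
  /-- as many pairs are drawn as the graph has edges -/
  length_trace : (trace w [(Sum.inl true, Sum.inl false)]).length = 2 * n + 1
  /-- the letters record the wavy edges and their propagators -/
  melon : ∀ l, some l ∈ w → G.wavy l.v = l.v' ∧ G.wavy l.v' = l.v ∧ G.prop l.v = l.π ∧
    G.prop l.v' = l.π'
  /-- every vertex lies on a letter -/
  vertex : ∀ u, ∃ l, some l ∈ w ∧ (u = l.v ∨ u = l.v')
  /-- there is one letter for each edge -/
  length : w.length = 2 * n + 1
  /-- there is one letter `some l` for each wavy edge -/
  melons : 2 * w.reduceOption.length = n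

/-- A graph is determined by a code together with the orientations of its parent-edges. -/
theorem IsCode.unique {G G' : FeynmanGraph n} {w : List (Option (Melon n))} (h : IsCode G w)
    (h' : IsCode G' w) (hi : G.ingoing = G'.ingoing) : G = G' := by
  have hv : ∀ u, G.wavy u = G'.wavy u ∧ G.prop u = G'.prop u := by
    intro u
    obtain ⟨l, hl, rfl | rfl⟩ := h.vertex u
    · obtain ⟨a, b, c, d⟩ := h.melon l hl
      obtain ⟨a', b', c', d'⟩ := h'.melon l hl
      exact ⟨a.trans a'.symm, c.trans c'.symm⟩
    · obtain ⟨a, b, c, d⟩ := h.melon l hl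
      obtain ⟨a', b', c', d'⟩ := h'.melon l hl
      exact ⟨b.trans b'.symm, d.trans d'.symm⟩
  refine FeynmanGraph.ext ?_ hi (funext fun u => (hv u).1) (funext fun u => (hv u).2)
  funext x
  obtain ⟨e, he, rfl | rfl⟩ := h.cover x
  · rw [h.edge e he, h'.edge e he]
  · rw [← h.edge e he, G.edge_edge, h.edge e he, ← h'.edge e he, G'.edge_edge]

/-- The half-edges met while a code is read are all different, since there are as many of them as
half-edges of the graph. -/
theorem IsCode.nodup {G : FeynmanGraph n} {w : List (Option (Melon n))} (h : IsCode G w) :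
    ((trace w [(Sum.inl true, Sum.inl false)]).flatMap fun e => [e.1, e.2]).Nodup := by
  set L := (trace w [(Sum.inl true, Sum.inl false)]).flatMap fun e => [e.1, e.2] with hL
  have h1 : L.length = 2 + n * 4 := by
    simp only [hL, List.length_flatMap, List.length_cons, List.length_nil, List.map_const',
      List.sum_replicate, h.length_trace, smul_eq_mul]
    ring
  have h2 : L.toFinset = Finset.univ := by
    refine Finset.eq_univ_of_forall fun x => ?_
    obtain ⟨e, he, hx⟩ := h.cover x
    simp only [hL, List.mem_toFinset, List.mem_flatMap]
    exact ⟨e, he, by simpa using hx⟩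
  rw [← Multiset.coe_nodup, ← Multiset.toFinset_card_eq_card_iff_nodup]
  have h3 : (L : Multiset (HalfEdge n)).toFinset = Finset.univ := h2
  rw [h3, Multiset.coe_card, h1]
  simp

theorem relabel_injective {m : ℕ} {f : Fin m → Fin n} (hf : Function.Injective f) :
    Function.Injective (HalfEdge.relabel f) := by
  rintro (a | ⟨u, c⟩) (b | ⟨u', c'⟩) h <;> simp_all [HalfEdge.relabel]
  exact hf h.1

/-- Insertion of a melon on an edge of a coded graph, with the melon read in the direction in which
the code reads the edge. -/
theorem IsCode.insert {G : FeynmanGraph (n + 2)} {H : FeynmanGraph n}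
    {w : List (Option (Melon n))} (hw : IsCode H w) (f : Fin n ↪o Fin (n + 2)) (v v' : Fin (n + 2))
    (a : Fin 4) (hrange : ∀ u, u = v ∨ u = v' ∨ u ∈ Set.range f)
    (hwavy : G.wavy v = v')
    (hlines : ∀ c, c ≠ a → G.edge (Sum.inr (v, c)) = Sum.inr (v', G.prop v c))
    (hfw : ∀ u, f (H.wavy u) = G.wavy (f u)) (hfp : ∀ u, H.prop u = G.prop (f u))
    (d : HalfEdge n × HalfEdge n) (hd : d ∈ trace w [(Sum.inl true, Sum.inl false)])
    (hd1 : d.1.relabel f = G.edge (Sum.inr (v, a)))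
    (hd2 : d.2.relabel f = G.edge (Sum.inr (v', G.prop v a)))
    (hedge : ∀ h, h ≠ d.1 → h ≠ d.2 → (H.edge h).relabel f = G.edge (h.relabel f)) :
    ∃ w', IsCode G w' := by
  obtain ⟨E₁, E₂, hE⟩ := List.append_of_mem hd
  set l : Melon (n + 2) := ⟨v, v', a, G.prop v, G.prop v'⟩ with hl
  have htr := trace_map f w [(Sum.inl true, Sum.inl false)]
  rw [hE] at htr
  simp only [List.map_append, List.map_cons, List.map_nil, Prod.map, HalfEdge.relabel] at htr
  obtain ⟨w₁, w₂, hw12, htr'⟩ := exists_trace_insert l _ _ _ _ _ htr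
  have hnd := hw.nodup
  rw [hE] at hnd
  have hne : ∀ e ∈ E₁ ++ E₂, e.1 ≠ d.1 ∧ e.1 ≠ d.2 := by
    intro e he
    simp only [List.flatMap_append, List.flatMap_cons] at hnd
    rw [List.nodup_append] at hnd
    obtain ⟨-, h2, h3⟩ := hnd
    rw [List.mem_append] at he
    rcases he with he | he
    · have hm : e.1 ∈ List.flatMap (fun e => [e.1, e.2]) E₁ :=
        List.mem_flatMap.2 ⟨e, he, by simp⟩
      exact ⟨h3 _ hm _ (by simp), h3 _ hm _ (by simp)⟩
    · have hm : e.1 ∈ List.flatMap (fun e => [e.1, e.2]) E₂ :=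
        List.mem_flatMap.2 ⟨e, he, by simp⟩
      rw [List.nodup_append] at h2
      exact ⟨(h2.2.2 _ (by simp) _ hm).symm, (h2.2.2 _ (by simp) _ hm).symm⟩
  have hold : ∀ e ∈ E₁ ++ E₂, e ∈ trace w [(Sum.inl true, Sum.inl false)] := by
    intro e he
    rw [hE]
    simp only [List.mem_append, List.mem_cons] at he ⊢
    tauto
  have hE12 : ∀ e, e ∈ trace w [(Sum.inl true, Sum.inl false)] ↔ e = d ∨ e ∈ E₁ ++ E₂ := by
    intro e
    rw [hE]
    simp only [List.mem_append, List.mem_cons]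
    tauto
  set w' := w₁ ++ some l :: (List.replicate 3 none ++ w₂) with hw'
  have hmem : ∀ e, e ∈ trace w' [(Sum.inl true, Sum.inl false)] ↔
      e = (d.1.relabel f, l.entry) ∨ e ∈ l.lines ∨ e = (l.exit, d.2.relabel f) ∨
        ∃ e' ∈ E₁ ++ E₂, (e'.1.relabel f, e'.2.relabel f) = e := by
    intro e
    rw [htr']
    simp only [List.mem_append, List.mem_cons, List.mem_map, Prod.map]
    constructor
    · rintro (⟨e', h1, rfl⟩ | h | h | h | ⟨e', h1, rfl⟩)
      · exact Or.inr (Or.inr (Or.inr ⟨e', Or.inl h1, rfl⟩))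
      · exact Or.inl h
      · exact Or.inr (Or.inl h)
      · exact Or.inr (Or.inr (Or.inl h))
      · exact Or.inr (Or.inr (Or.inr ⟨e', Or.inr h1, rfl⟩))
    · rintro (h | h | h | ⟨e', h1 | h1, rfl⟩)
      · exact Or.inr (Or.inl h)
      · exact Or.inr (Or.inr (Or.inl h))
      · exact Or.inr (Or.inr (Or.inr (Or.inl h)))
      · exact Or.inl ⟨e', h1, rfl⟩
      · exact Or.inr (Or.inr (Or.inr (Or.inr ⟨e', h1, rfl⟩)))
  have hletter : ∀ k, some k ∈ w' ↔ k = l ∨ ∃ k', some k' ∈ w ∧ k'.map f = k := by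
    intro k
    have h1 : some k ∈ w.map (Option.map (Melon.map f)) ↔ some k ∈ w₁ ∨ some k ∈ w₂ := by
      rw [hw12, List.mem_append]
    have h2 : some k ∈ w.map (Option.map (Melon.map f)) ↔ ∃ k', some k' ∈ w ∧ k'.map f = k := by
      simp only [List.mem_map]
      constructor
      · rintro ⟨_ | k', h, h'⟩
        · simp at h'
        · exact ⟨k', h, by simpa using h'⟩
      · rintro ⟨k', h, rfl⟩
        exact ⟨some k', h, rfl⟩
    rw [← h2, h1]
    simp [hw']
    tauto
  have hww : G.wavy v' = v := by rw [← hwavy, G.wavy_wavy]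
  refine ⟨w', ?_, ?_, ?_, ?_, ?_, ?_, ?_⟩
  · intro e he
    rcases (hmem e).1 he with rfl | h | rfl | ⟨e', h1, rfl⟩
    · simp only [hd1, G.edge_edge, hl, Melon.entry]
    · obtain ⟨c, hc, rfl⟩ := Melon.mem_lines.1 h
      exact hlines c hc
    · exact hd2.symm
    · have := hedge e'.1 (hne e' h1).1 (hne e' h1).2
      rw [hw.edge e' (hold e' h1)] at this
      exact this.symm
  · -- each vertex is `v`, or `v'`, or comes from the smaller graph
    have hbij : ∀ c, ∃ c', G.prop v c' = c := fun c =>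
      ⟨G.prop v' c, by simpa [hww] using G.prop_prop v' c⟩
    have hin : ∀ h : HalfEdge n, ∃ e ∈ trace w' [(Sum.inl true, Sum.inl false)],
        h.relabel f = e.1 ∨ h.relabel f = e.2 := by
      intro h
      obtain ⟨e, he, hx⟩ := hw.cover h
      rcases (hE12 e).1 he with rfl | h1
      · rcases hx with rfl | rfl
        · exact ⟨_, (hmem _).2 (Or.inl rfl), Or.inl rfl⟩
        · exact ⟨_, (hmem _).2 (Or.inr (Or.inr (Or.inl rfl))), Or.inr rfl⟩
      · refine ⟨_, (hmem _).2 (Or.inr (Or.inr (Or.inr ⟨e, h1, rfl⟩))), ?_⟩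
        rcases hx with rfl | rfl
        · exact Or.inl rfl
        · exact Or.inr rfl
    rintro (b | ⟨u, c⟩)
    · exact hin (Sum.inl b)
    rcases hrange u with rfl | rfl | ⟨u, rfl⟩
    · by_cases hc : c = a
      · subst hc
        exact ⟨_, (hmem _).2 (Or.inl rfl), Or.inr rfl⟩
      · exact ⟨_, (hmem _).2 (Or.inr (Or.inl (Melon.mem_lines.2 ⟨c, hc, rfl⟩))), Or.inl rfl⟩
    · obtain ⟨c, rfl⟩ := hbij c
      by_cases hc : c = a
      · subst hc
        exact ⟨_, (hmem _).2 (Or.inr (Or.inr (Or.inl rfl))), Or.inl rfl⟩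
      · exact ⟨_, (hmem _).2 (Or.inr (Or.inl (Melon.mem_lines.2 ⟨c, hc, rfl⟩))), Or.inr rfl⟩
    · exact hin (Sum.inr (u, c))
  · have := hw.length_trace
    rw [hE] at this
    rw [htr']
    simp only [List.length_append, List.length_cons, List.length_map, l.length_lines] at this ⊢
    omega
  · intro k hk
    rcases (hletter k).1 hk with rfl | ⟨k', hk', rfl⟩
    · exact ⟨hwavy, hww, rfl, rfl⟩
    · obtain ⟨h1, h2, h3, h4⟩ := hw.melon k' hk'
      simp only [Melon.map, ← hfw, ← hfp, h1, h2, h3, h4, and_self]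
  · intro u
    rcases hrange u with rfl | rfl | ⟨u, rfl⟩
    · exact ⟨l, (hletter l).2 (Or.inl rfl), Or.inl rfl⟩
    · exact ⟨l, (hletter l).2 (Or.inl rfl), Or.inr rfl⟩
    · obtain ⟨k, hk, hu⟩ := hw.vertex u
      refine ⟨k.map f, (hletter _).2 (Or.inr ⟨k, hk, rfl⟩), ?_⟩
      rcases hu with rfl | rfl
      · exact Or.inl rfl
      · exact Or.inr rfl
  · have h1 := congrArg List.length hw12
    have h2 := hw.length
    simp only [hw', List.length_append, List.length_cons, List.length_map,
      List.length_replicate] at h1 ⊢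
    omega
  · have h1 := congrArg (fun w => w.reduceOption.length) hw12
    have h2 := hw.melons
    simp only [List.reduceOption_append, List.length_append, List.reduceOption_map,
      List.length_map] at h1
    simp only [hw', List.reduceOption_append, List.reduceOption_cons_of_some, List.length_append,
      List.length_cons]
    simp
    omega

theorem FeynmanGraph.edge_ne (G : FeynmanGraph n) (h : HalfEdge n) : G.edge h ≠ h := by
  intro e
  have := G.isOut_edge h
  rw [e] at this
  simp at this

/-- The fourth line of a melon cannot join its two vertices: the heap-order would make each of them
smaller than the other. -/
theorem FeynmanGraph.edge_external_ne (G : FeynmanGraph n) (v : Fin n) (a : Fin 4)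
    (hlines : ∀ c, c ≠ a → G.edge (Sum.inr (v, c)) = Sum.inr (G.wavy v, G.prop v c)) :
    G.edge (Sum.inr (v, a)) ≠ Sum.inr (G.wavy v, G.prop v a) := by
  intro h
  have hall : ∀ c, G.edge (Sum.inr (v, c)) = Sum.inr (G.wavy v, G.prop v c) := by
    intro c
    by_cases hc : c = a
    · rw [hc, h]
    · exact hlines c hc
  have h1 := G.heap v
  rw [hall 0] at h1
  have h2 := G.heap (G.wavy v)
  have h3 := G.prop_prop (G.wavy v) 0
  rw [G.wavy_wavy] at h3
  have h4 := hall (G.prop (G.wavy v) 0)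
  rw [h3] at h4
  rw [← h4, G.edge_edge] at h2
  simp only [HalfEdge.IsSlotFor] at h1 h2
  exact absurd h1.2 h2.2.asymm

/-- Every melonic graph has a code: undo the reductions one by one, inserting each melon in the
code of the smaller graph. -/
theorem exists_isCode {G : FeynmanGraph n} (h : G.IsMelonic) : ∃ w, IsCode G w := by
  induction h with
  | trivial G =>
    refine ⟨[none], ?_, ?_, ?_, ?_, ?_, ?_, ?_⟩
    · have h := G.isOut_edge (Sum.inl true)
      simp only [trace, List.mem_cons, List.not_mem_nil, or_false, forall_eq]
      rcases hx : G.edge (Sum.inl true) with b | ⟨u, c⟩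
      · rw [hx] at h
        simp only [HalfEdge.isOut, Bool.not_true] at h
        rw [h]
      · exact u.elim0
    · rintro ((_ | _) | ⟨u, c⟩)
      · simp [trace]
      · simp [trace]
      · exact u.elim0
    · simp [trace]
    · simp
    · exact fun u => u.elim0
    · simp
    · simp
  | @step n G H hred _ ih =>
    obtain ⟨w, hw⟩ := ih
    obtain ⟨f, v, a, hv, hv', hlines, hedge, -, hwavy, hprop⟩ := hred
    have hne := G.edge_external_ne v a hlines
    have hvv : G.wavy v ≠ v := G.wavy_ne v
    have hrange : ∀ u, u = v ∨ u = G.wavy v ∨ u ∈ Set.range f := by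
      have hcard : (insert v (insert (G.wavy v) (Finset.univ.map f.toEmbedding))) =
          Finset.univ := by
        apply Finset.eq_univ_of_card
        rw [Finset.card_insert_of_notMem, Finset.card_insert_of_notMem, Finset.card_map]
        · simp
        · simpa using hv'
        · simp only [Finset.mem_insert, not_or]
          exact ⟨hvv.symm, by simpa using hv⟩
      intro u
      have : u ∈ insert v (insert (G.wavy v) (Finset.univ.map f.toEmbedding)) := by
        rw [hcard]; simp
      simpa using this
    have hinv : ∀ c, G.prop v (G.prop (G.wavy v) c) = c := fun c => by
      simpa [G.wavy_wavy] using G.prop_prop (G.wavy v) c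
    have hlines' : ∀ c, c ≠ G.prop v a →
        G.edge (Sum.inr (G.wavy v, c)) = Sum.inr (v, G.prop (G.wavy v) c) := by
      intro c hc
      have h1 := hlines (G.prop (G.wavy v) c) (by
        intro h
        exact hc (by rw [← h, hinv]))
      rw [hinv] at h1
      rw [← h1, G.edge_edge]
    -- the external half-edge of `v` is joined to a half-edge of the smaller graph
    obtain ⟨x, hx⟩ : ∃ x : HalfEdge n, x.relabel f = G.edge (Sum.inr (v, a)) := by
      rcases hq : G.edge (Sum.inr (v, a)) with b | ⟨u, c⟩
      · exact ⟨Sum.inl b, rfl⟩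
      · have hq' : G.edge (Sum.inr (u, c)) = Sum.inr (v, a) := by rw [← hq, G.edge_edge]
        rcases hrange u with rfl | rfl | ⟨u, rfl⟩
        · by_cases hc : c = a
          · subst hc; exact absurd hq' (G.edge_ne _)
          · rw [hlines c hc] at hq'
            simp only [Sum.inr.injEq, Prod.mk.injEq] at hq'
            exact absurd hq'.1 hvv
        · by_cases hc : c = G.prop v a
          · subst hc; exact absurd hq hne
          · rw [hlines' c hc] at hq'
            simp only [Sum.inr.injEq, Prod.mk.injEq] at hq'
            exact absurd (by rw [← hq'.2, hinv]) hc
        · exact ⟨Sum.inr (u, c), rfl⟩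
    have hx2 : (H.edge x).relabel f = G.edge (Sum.inr (G.wavy v, G.prop v a)) := by
      rw [hedge, hx, G.edge_edge, if_pos rfl]
    have hother : ∀ h, h ≠ x → h ≠ H.edge x → (H.edge h).relabel f = G.edge (h.relabel f) := by
      intro h h1 h2
      have hinj := relabel_injective (f := f) f.injective
      rw [hedge, if_neg, if_neg]
      · intro h3
        apply h2
        apply hinj
        rw [hx2, ← h3, G.edge_edge]
      · intro h3
        apply h1
        apply hinj
        rw [hx, ← h3, G.edge_edge]
    obtain ⟨d, hd, rfl | rfl⟩ := hw.cover x
    · rw [hw.edge d hd] at hx2 hother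
      exact hw.insert f v (G.wavy v) a hrange rfl hlines hwavy hprop d hd hx hx2 hother
    · have hd1 : d.1 = H.edge d.2 := by rw [← hw.edge d hd, H.edge_edge]
      rw [← hd1] at hx2 hother
      refine hw.insert f (G.wavy v) v (G.prop v a) ?_ (G.wavy_wavy v) hlines' hwavy hprop d hd hx2
        ?_ fun h h1 h2 => hother h h2 h1
      · intro u
        rcases hrange u with h | h | h
        · exact Or.inr (Or.inl h)
        · exact Or.inl h
        · exact Or.inr (Or.inr h)
      · rw [G.prop_prop]; exact hx

/-! ### The number of melonic graphs -/

theorem eq_of_map_isSome_of_reduceOption {α : Type*} :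
    ∀ {w w' : List (Option α)}, w.map Option.isSome = w'.map Option.isSome →
      w.reduceOption = w'.reduceOption → w = w'
  | [], [], _, _ => rfl
  | [], _ :: _, h, _ => by simp at h
  | _ :: _, [], h, _ => by simp at h
  | none :: w, none :: w', h, h' => by
    simp only [List.map_cons, List.cons.injEq, List.reduceOption_cons_of_none] at h h'
    rw [eq_of_map_isSome_of_reduceOption h.2 h']
  | none :: w, some b :: w', h, h' => by simp at h
  | some b :: w, none :: w', h, h' => by simp at h
  | some b :: w, some c :: w', h, h' => by
    simp only [List.map_cons, List.cons.injEq, List.reduceOption_cons_of_some] at h h'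
    rw [eq_of_map_isSome_of_reduceOption h.2 h'.2, h'.1]

noncomputable instance (n : ℕ) : Fintype (Melon n) :=
  Fintype.ofInjective Melon.toProd Melon.toProd_injective

theorem card_melon_le (n : ℕ) : Fintype.card (Melon n) ≤ n ^ 2 * 2 ^ 18 := by
  refine (Fintype.card_le_of_injective _ Melon.toProd_injective).trans (le_of_eq ?_)
  simp
  ring

open Classical in
/-- A melonic graph is determined by its orientations, the shape of a code and the labels in it. -/
theorem card_isMelonic_le (m : ℕ) :
    ((Finset.univ : Finset (FeynmanGraph (2 * m))).filter fun G => G.IsMelonic).card ≤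
      2 ^ (2 * m) * (2 ^ (2 * (2 * m) + 1) * ((2 * m) ^ 2 * 2 ^ 18) ^ m) := by
  have hcode : ∀ G : {G : FeynmanGraph (2 * m) // G.IsMelonic}, ∃ w, IsCode G.1 w :=
    fun G => exists_isCode G.2
  choose w hw using hcode
  let F : {G : FeynmanGraph (2 * m) // G.IsMelonic} →
      (Fin (2 * m) → Bool) × List.Vector Bool (2 * (2 * m) + 1) × List.Vector (Melon (2 * m)) m :=
    fun G => (G.1.ingoing, ⟨(w G).map Option.isSome, by rw [List.length_map, (hw G).length]⟩,
      ⟨(w G).reduceOption, by have := (hw G).melons; omega⟩)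
  have hF : Function.Injective F := by
    intro G G' h
    simp only [F, Prod.mk.injEq] at h
    have h4 := eq_of_map_isSome_of_reduceOption (congrArg (fun z => z.1.1) h.2)
      (congrArg (fun z => z.2.1) h.2)
    have h1 := h.1
    have h5 := hw G'
    rw [← h4] at h5
    exact Subtype.ext ((hw G).unique h5 h1)
  have h := Fintype.card_le_of_injective F hF
  rw [Fintype.card_subtype] at h
  refine h.trans ?_
  simp only [Fintype.card_prod, card_vector, Fintype.card_fun, Fintype.card_bool, Fintype.card_fin]
  gcongr
  exact card_melon_le _

open Classical in
/-- Up to the factor `n!` that counts the labellings, the number of melonic graphs grows at most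
exponentially with the order. -/
theorem card_isMelonic_le_factorial (m : ℕ) :
    (((Finset.univ : Finset (FeynmanGraph (2 * m))).filter fun G => G.IsMelonic).card : ℝ) ≤
      2 * (2 ^ 28) ^ m * ((2 * m).factorial : ℝ) := by
  have h1 : ((2 * m : ℕ) : ℝ) ^ (2 * m) ≤ 16 ^ m * ((2 * m).factorial : ℝ) := by
    have h := Real.pow_div_factorial_le_exp ((2 * m : ℕ) : ℝ) (Nat.cast_nonneg _) (2 * m)
    rw [div_le_iff₀ (by positivity)] at h
    refine h.trans ?_
    gcongr
    have h2 : Real.exp ((2 * m : ℕ) : ℝ) = Real.exp 1 ^ (2 * m) := by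
      rw [← Real.exp_nat_mul, mul_one]
    have h3 : Real.exp 1 ≤ 4 := by have := Real.exp_one_lt_d9; linarith
    calc Real.exp ((2 * m : ℕ) : ℝ) = Real.exp 1 ^ (2 * m) := h2
      _ ≤ 4 ^ (2 * m) := by gcongr
      _ = 16 ^ m := by rw [pow_mul]; norm_num
  calc (((Finset.univ : Finset (FeynmanGraph (2 * m))).filter fun G => G.IsMelonic).card : ℝ)
      ≤ ((2 ^ (2 * m) * (2 ^ (2 * (2 * m) + 1) * ((2 * m) ^ 2 * 2 ^ 18) ^ m) : ℕ) : ℝ) := by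
        exact_mod_cast card_isMelonic_le m
    _ = 2 * (2 ^ 24) ^ m * ((2 * m : ℕ) : ℝ) ^ (2 * m) := by
        have e1 : (2 : ℝ) ^ (2 * (2 * m) + 1) = 2 * 16 ^ m := by
          rw [pow_succ, ← mul_assoc, pow_mul]; norm_num; ring
        have e2 : (2 : ℝ) ^ (2 * m) = 4 ^ m := by rw [pow_mul]; norm_num
        have e3 : ((2 : ℝ) ^ 24) ^ m = 4 ^ m * 16 ^ m * (2 ^ 18) ^ m := by
          rw [← mul_pow, ← mul_pow]; norm_num
        push_cast
        rw [e1, e2, e3, mul_pow, ← pow_mul (2 * (m : ℝ))]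
        ring
    _ ≤ 2 * (2 ^ 24) ^ m * (16 ^ m * ((2 * m).factorial : ℝ)) := by gcongr
    _ = 2 * (2 ^ 28) ^ m * ((2 * m).factorial : ℝ) := by
        have : ((2 : ℝ) ^ 28) ^ m = (2 ^ 24) ^ m * 16 ^ m := by rw [← mul_pow]; norm_num
        rw [this]; ring

/-! ### Momenta are determined by the leaves -/

namespace FeynmanGraph

theorem mem_leaves {G : FeynmanGraph n} {h : HalfEdge n} :
    h ∈ G.leaves ↔ HalfEdge.isOut G.ingoing h = true ∧ ¬ h.IsParent ∧ ¬ (G.edge h).IsParent := by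
  simp [leaves]

/-- A child or root half-edge lies on a dashed edge, or carries a true vertex. -/
theorem leaf_or_parent (G : FeynmanGraph n) {h : HalfEdge n} (hp : ¬ h.IsParent) :
    h ∈ G.leaves ∨ G.edge h ∈ G.leaves ∨ ∃ u, G.edge h = Sum.inr (u, 0) := by
  by_cases he : (G.edge h).IsParent
  · right; right
    rcases hx : G.edge h with b | ⟨u, c⟩
    · rw [hx] at he; exact he.elim
    · rw [hx] at he
      simp only [HalfEdge.IsParent] at he
      exact ⟨u, by rw [he]⟩
  · cases ho : HalfEdge.isOut G.ingoing h
    · right; left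
      rw [mem_leaves, G.isOut_edge, G.edge_edge, ho]
      exact ⟨rfl, he, hp⟩
    · left
      exact mem_leaves.2 ⟨ho, hp, he⟩

/-- A vertex that hangs on a child half-edge of `v` has a larger label than `v`. -/
theorem lt_of_edge_eq (G : FeynmanGraph n) {v u : Fin n} {c : Fin 4}
    (h : G.edge (Sum.inr (v, c)) = Sum.inr (u, 0)) : v < u := by
  have h1 := G.heap u
  rw [← h, G.edge_edge] at h1
  exact h1.2

/-- Descending induction along the heap-order. -/
theorem heap_induction (Q : Fin n → Prop) (h : ∀ v, (∀ u, v < u → Q u) → Q v) : ∀ v, Q v := by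
  intro v
  induction v using WellFoundedGT.induction with
  | ind v ih => exact h v ih

/-- The momenta of all edges are determined by those of the dashed edges: at each true vertex the
momentum of the parent-edge is determined by those of the children-edges. -/
theorem IsMomentum.eq_of_leaves {G : FeynmanGraph n} {r r' : ℕ} {i i' : Fin n → Fin 4 → ℕ}
    (hi : G.IsMomentum r i) (hi' : G.IsMomentum r' i')
    (h : ∀ x ∈ G.leaves, halfEdgeMomentum r i x = halfEdgeMomentum r' i' x) : r = r' ∧ i = i' := by
  have slot : ∀ x : HalfEdge n, ¬ x.IsParent →
      (∀ u, G.edge x = Sum.inr (u, 0) → i u 0 = i' u 0) →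
      halfEdgeMomentum r i x = halfEdgeMomentum r' i' x := by
    intro x hx hu
    rcases G.leaf_or_parent hx with h1 | h1 | ⟨u, h1⟩
    · exact h _ h1
    · rw [← hi.edge x, ← hi'.edge x]; exact h _ h1
    · rw [← hi.edge x, ← hi'.edge x, h1]; exact hu u h1
  have hv : ∀ v, ∀ c, i v c = i' v c := by
    refine heap_induction _ fun v ih => ?_
    have hc : ∀ c, c ≠ 0 → i v c = i' v c := fun c hc =>
      slot (Sum.inr (v, c)) hc fun u hu => ih u (G.lt_of_edge_eq hu) 0
    have h1 := hc 1 (by decide)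
    have h2 := hc 2 (by decide)
    have h3 := hc 3 (by decide)
    have h4 := hi.resonance v
    have h5 := hi'.resonance v
    intro c
    by_cases h0 : c = 0
    · subst h0; omega
    · exact hc c h0
  exact ⟨slot (Sum.inl true) (fun h => h) fun u _ => hv u 0,
    funext fun v => funext fun c => hv v c⟩

/-- The root momentum is bounded by those of the dashed edges.  The factor `2 ^ n` is not optimal:
each true vertex on the way from a leaf to the root costs a factor of at most `2`. -/
theorem IsMomentum.root_le {G : FeynmanGraph n} {r : ℕ} {i : Fin n → Fin 4 → ℕ}
    (hi : G.IsMomentum r i) : r ≤ 2 ^ n * ∑ x ∈ G.leaves, halfEdgeMomentum r i x := by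
  set L := ∑ x ∈ G.leaves, halfEdgeMomentum r i x with hL
  have hle : ∀ x ∈ G.leaves, halfEdgeMomentum r i x ≤ L := fun x hx =>
    Finset.single_le_sum (f := fun x => halfEdgeMomentum r i x) (fun _ _ => Nat.zero_le _) hx
  have slot : ∀ (K : ℕ) (x : HalfEdge n), ¬ x.IsParent → L ≤ K →
      (∀ u, G.edge x = Sum.inr (u, 0) → i u 0 ≤ K) → halfEdgeMomentum r i x ≤ K := by
    intro K x hx hK hu
    rcases G.leaf_or_parent hx with h1 | h1 | ⟨u, h1⟩
    · exact (hle _ h1).trans hK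
    · rw [← hi.edge x]; exact (hle _ h1).trans hK
    · rw [← hi.edge x, h1]; exact hu u h1
  have hpow : ∀ k, L ≤ 2 ^ k * L := fun k => Nat.le_mul_of_pos_left _ (by positivity)
  have hv : ∀ v : Fin n, i v 0 ≤ 2 ^ (n - v.1) * L := by
    refine heap_induction _ fun v ih => ?_
    have hc : ∀ c, c ≠ 0 → i v c ≤ 2 ^ (n - v.1 - 1) * L := by
      intro c hc
      refine slot _ (Sum.inr (v, c)) hc (hpow _) fun u hu => ?_
      have hlt : v.1 < u.1 := G.lt_of_edge_eq hu
      exact (ih u hlt).trans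
        (Nat.mul_le_mul_right _ (Nat.pow_le_pow_right (by norm_num) (by omega)))
    have h2 := hc 2 (by decide)
    have h3 := hc 3 (by decide)
    have h4 := hi.resonance v
    have h5 : 2 ^ (n - v.1) = 2 * 2 ^ (n - v.1 - 1) := by
      rw [← pow_succ']; congr 1; have := v.2; omega
    rw [h5, mul_assoc]
    omega
  refine slot _ (Sum.inl true) (fun h => h) (hpow n) fun u _ => (hv u).trans ?_
  exact Nat.mul_le_mul_right _ (Nat.pow_le_pow_right (by norm_num) (by omega))

/-- There are at most `n + 1` leaves: the leaves, their partners, the parent half-edges and their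
partners are all different. -/
theorem card_leaves_le (G : FeynmanGraph n) : G.leaves.card ≤ n + 1 := by
  classical
  have hinj : Function.Injective G.edge := fun x y h => by
    rw [← G.edge_edge x, h, G.edge_edge]
  let F : (G.leaves ⊕ G.leaves) ⊕ (Fin n ⊕ Fin n) → HalfEdge n :=
    Sum.elim (Sum.elim (fun x => x.1) (fun x => G.edge x.1))
      (Sum.elim (fun v => Sum.inr (v, 0)) (fun v => G.edge (Sum.inr (v, 0))))
  have hF : Function.Injective F := by
    have hA : ∀ x y : G.leaves, (x : HalfEdge n) ≠ G.edge y := by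
      intro x y h
      have h1 := (mem_leaves.1 x.2).1
      rw [h, G.isOut_edge, (mem_leaves.1 y.2).1] at h1
      simp at h1
    have hB : ∀ (x : G.leaves) (v : Fin n), (x : HalfEdge n) ≠ Sum.inr (v, 0) := by
      intro x v h
      have h1 := (mem_leaves.1 x.2).2.1
      rw [h] at h1
      exact h1 rfl
    have hC : ∀ (x : G.leaves) (v : Fin n), (x : HalfEdge n) ≠ G.edge (Sum.inr (v, 0)) := by
      intro x v h
      have h1 := (mem_leaves.1 x.2).2.2
      rw [h, G.edge_edge] at h1
      exact h1 rfl
    have hD : ∀ v u : Fin n, (Sum.inr (v, 0) : HalfEdge n) ≠ G.edge (Sum.inr (u, 0)) := by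
      intro v u h
      have h1 := G.heap u
      rw [← h] at h1
      exact h1.1 rfl
    have hswap : ∀ x y : HalfEdge n, G.edge x = y → x = G.edge y := fun x y h => by
      rw [← h, G.edge_edge]
    rintro ((x | x) | (x | x)) ((y | y) | (y | y)) h <;> simp only [F, Sum.elim_inl, Sum.elim_inr] at h
    · rw [Subtype.ext h]
    · exact absurd h (hA x y)
    · exact absurd h (hB x y)
    · exact absurd h (hC x y)
    · exact absurd h.symm (hA y x)
    · rw [Subtype.ext (hinj h)]
    · exact absurd (hswap _ _ h) (hC x y)
    · exact absurd (hinj h) (hB x y)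
    · exact absurd h.symm (hB y x)
    · exact absurd (hswap _ _ h.symm) (hC y x)
    · simpa using h
    · exact absurd h (hD x y)
    · exact absurd h.symm (hC y x)
    · exact absurd (hinj h).symm (hB y x)
    · exact absurd h.symm (hD y x)
    · simpa using hinj h
  have h := Fintype.card_le_of_injective F hF
  simp only [Fintype.card_sum, Fintype.card_coe, Fintype.card_fin, Fintype.card_bool,
    Fintype.card_prod] at h
  omega

end FeynmanGraph

/-! ### Moments of the amplitudes -/

theorem summable_prod_geometric {ι : Type*} [Fintype ι] {q : ℝ} (hq : 0 ≤ q) (hq' : q < 1) :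
    Summable (fun x : ι → ℕ => ∏ j, q ^ x j) ∧
      ∑' x : ι → ℕ, ∏ j, q ^ x j ≤ (1 / (1 - q)) ^ Fintype.card ι := by
  classical
  have hsum : ∀ s : Finset (ι → ℕ), ∑ x ∈ s, ∏ j, q ^ x j ≤ (1 / (1 - q)) ^ Fintype.card ι := by
    intro s
    set M := s.sup (fun x => Finset.univ.sup x) + 1 with hM
    have hs : s ⊆ Fintype.piFinset fun _ => Finset.range M := by
      intro x hx
      rw [Fintype.mem_piFinset]
      intro j
      rw [Finset.mem_range, hM, Nat.lt_succ_iff]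
      exact (Finset.le_sup (Finset.mem_univ j)).trans (Finset.le_sup (f := fun x => Finset.univ.sup x) hx)
    calc ∑ x ∈ s, ∏ j, q ^ x j
        ≤ ∑ x ∈ Fintype.piFinset fun _ : ι => Finset.range M, ∏ j, q ^ x j :=
          Finset.sum_le_sum_of_subset_of_nonneg hs fun _ _ _ =>
            Finset.prod_nonneg fun _ _ => pow_nonneg hq _
      _ = ∏ _j : ι, ∑ k ∈ Finset.range M, q ^ k :=
          (Finset.prod_univ_sum (fun _ => Finset.range M) fun _ k => q ^ k).symm
      _ ≤ ∏ _j : ι, (1 / (1 - q)) := by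
          refine Finset.prod_le_prod (fun _ _ => Finset.sum_nonneg fun _ _ => pow_nonneg hq _)
            fun _ _ => ?_
          rw [one_div, ← tsum_geometric_of_lt_one hq hq']
          exact (summable_geometric_of_lt_one hq hq').sum_le_tsum _ fun _ _ => pow_nonneg hq _
      _ = (1 / (1 - q)) ^ Fintype.card ι := by simp
  have hnn : ∀ x : ι → ℕ, 0 ≤ ∏ j, q ^ x j := fun x => Finset.prod_nonneg fun _ _ => pow_nonneg hq _
  exact ⟨summable_of_sum_le hnn hsum, Real.tsum_le_of_sum_le hnn hsum⟩

theorem modeNumber_pos {p : ℝ} (hp : p < 1) : 0 < modeNumber p :=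
  one_div_pos.2 (sub_pos.2 hp)

theorem one_le_modeNumber {p : ℝ} (hp : 0 ≤ p) (hp' : p < 1) : 1 ≤ modeNumber p := by
  rw [modeNumber, le_div_iff₀ (sub_pos.2 hp')]
  linarith

/-- A power of the total momentum is controlled by a power of `N`, at the price of a slower
geometric decay: `p ≤ q ^ 2` with `q = (1 + p) / 2`, and one factor `q ^ y` absorbs `y ^ γ`. -/
theorem rpow_mul_pow_le {γ p : ℝ} (hγ : 0 < γ) (hp : 0 < p) (hp' : p < 1) (y : ℕ) :
    (y : ℝ) ^ γ * p ^ y ≤ (2 * γ * modeNumber p) ^ γ * ((1 + p) / 2) ^ y := by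
  have hN := modeNumber_pos hp'
  set q := (1 + p) / 2 with hq
  have hq0 : 0 ≤ q := by rw [hq]; linarith
  have h1 : p ≤ q * q := by rw [hq]; nlinarith [sq_nonneg (1 - p)]
  have h2 : q ≤ Real.exp (-(1 / (2 * modeNumber p))) := by
    have h := Real.add_one_le_exp (-(1 / (2 * modeNumber p)))
    refine le_trans (le_of_eq ?_) h
    rw [hq, modeNumber]
    have : (1 : ℝ) - p ≠ 0 := by linarith
    field_simp
    ring
  have h3 : (y : ℝ) ^ γ ≤ (2 * γ * modeNumber p) ^ γ * Real.exp (y / (2 * modeNumber p)) := by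
    have h := Real.add_one_le_exp ((y : ℝ) / (2 * modeNumber p) / γ)
    have h4 : (y : ℝ) ≤ 2 * γ * modeNumber p * Real.exp ((y : ℝ) / (2 * modeNumber p) / γ) := by
      calc (y : ℝ) = 2 * γ * modeNumber p * ((y : ℝ) / (2 * modeNumber p) / γ) := by field_simp
        _ ≤ _ := by gcongr; linarith
    calc (y : ℝ) ^ γ ≤ (2 * γ * modeNumber p * Real.exp ((y : ℝ) / (2 * modeNumber p) / γ)) ^ γ := by
          gcongr
      _ = _ := by
          rw [Real.mul_rpow (by positivity) (by positivity), ← Real.exp_mul,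
            div_mul_cancel₀ _ hγ.ne']
  have h5 : q ^ y ≤ Real.exp (-(y / (2 * modeNumber p))) := by
    calc q ^ y ≤ Real.exp (-(1 / (2 * modeNumber p))) ^ y := by gcongr
      _ = _ := by rw [← Real.exp_nat_mul]; congr 1; ring
  calc (y : ℝ) ^ γ * p ^ y ≤ (y : ℝ) ^ γ * (q * q) ^ y := by gcongr
    _ = (y : ℝ) ^ γ * q ^ y * q ^ y := by rw [mul_pow]; ring
    _ ≤ ((2 * γ * modeNumber p) ^ γ * Real.exp (y / (2 * modeNumber p))) *
          Real.exp (-(y / (2 * modeNumber p))) * q ^ y := by gcongr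
    _ = (2 * γ * modeNumber p) ^ γ * q ^ y := by
        rw [mul_assoc (_ ^ γ), ← Real.exp_add]; simp

namespace FeynmanGraph

/-- The momenta of the dashed edges. -/
def leafMomentum (G : FeynmanGraph n) (x : Σ r : ℕ, {i : Fin n → Fin 4 → ℕ // G.IsMomentum r i}) :
    G.leaves → ℕ :=
  fun h => halfEdgeMomentum x.1 x.2.1 h

theorem leafMomentum_injective (G : FeynmanGraph n) : Function.Injective G.leafMomentum := by
  rintro ⟨r, i, hi⟩ ⟨r', i', hi'⟩ h
  obtain ⟨rfl, rfl⟩ := hi.eq_of_leaves hi' fun x hx => congrFun h ⟨x, hx⟩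
  rfl

theorem weight_eq_prod (G : FeynmanGraph n) (p : ℝ)
    (x : Σ r : ℕ, {i : Fin n → Fin 4 → ℕ // G.IsMomentum r i}) :
    G.weight p x.1 x.2.1 = ∏ h, p ^ G.leafMomentum x h :=
  (Finset.prod_coe_sort G.leaves fun h => p ^ halfEdgeMomentum x.1 x.2.1 h).symm

theorem weight_nonneg (G : FeynmanGraph n) {p : ℝ} (hp : 0 ≤ p) (r : ℕ) (i : Fin n → Fin 4 → ℕ) :
    0 ≤ G.weight p r i :=
  Finset.prod_nonneg fun _ _ => pow_nonneg hp _

theorem summable_weight (G : FeynmanGraph n) {p : ℝ} (hp : 0 ≤ p) (hp' : p < 1) (r : ℕ) :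
    Summable fun i : {i : Fin n → Fin 4 → ℕ // G.IsMomentum r i} => G.weight p r i.1 := by
  have h := (summable_prod_geometric (ι := G.leaves) hp hp').1.comp_injective
    (G.leafMomentum_injective.comp (sigma_mk_injective (i := r)))
  exact h.congr fun i => (G.weight_eq_prod p ⟨r, i⟩).symm

/-- The moment of order `γ` of the amplitude of any graph: there is one free sum, of size `N`, for
each dashed edge. -/
theorem summable_rpow_mul_weight (G : FeynmanGraph n) {γ p : ℝ} (hγ : 0 < γ) (hp : 0 < p)
    (hp' : p < 1) :
    Summable (fun x : Σ r : ℕ, {i : Fin n → Fin 4 → ℕ // G.IsMomentum r i} =>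
        (x.1 : ℝ) ^ γ * G.weight p x.1 x.2.1) ∧
      ∑' x : Σ r : ℕ, {i : Fin n → Fin 4 → ℕ // G.IsMomentum r i},
          (x.1 : ℝ) ^ γ * G.weight p x.1 x.2.1 ≤
        (2 ^ n) ^ γ * (2 * γ * modeNumber p) ^ γ * (2 * modeNumber p) ^ (n + 1) := by
  have hN := modeNumber_pos hp'
  have hN1 := one_le_modeNumber hp.le hp'
  set q := (1 + p) / 2 with hq
  have hq0 : 0 ≤ q := by rw [hq]; linarith
  have hq1 : q < 1 := by rw [hq]; linarith
  have hqN : 1 / (1 - q) = 2 * modeNumber p := by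
    rw [hq, modeNumber]
    have : (1 : ℝ) - p ≠ 0 := by linarith
    have h2 : (1 : ℝ) - (1 + p) / 2 = (1 - p) / 2 := by ring
    rw [h2]
    field_simp
  obtain ⟨hs, ht⟩ := summable_prod_geometric (ι := G.leaves) hq0 hq1
  set K := (2 ^ n : ℝ) ^ γ * (2 * γ * modeNumber p) ^ γ with hK
  have hK0 : 0 ≤ K := by positivity
  have hle : ∀ x : Σ r : ℕ, {i : Fin n → Fin 4 → ℕ // G.IsMomentum r i},
      (x.1 : ℝ) ^ γ * G.weight p x.1 x.2.1 ≤ K * ∏ h, q ^ G.leafMomentum x h := by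
    intro x
    set y := ∑ h, G.leafMomentum x h with hy
    have hr : x.1 ≤ 2 ^ n * y := by
      have := x.2.2.root_le
      rwa [← Finset.sum_coe_sort] at this
    have hr' : (x.1 : ℝ) ≤ 2 ^ n * (y : ℝ) := by exact_mod_cast hr
    rw [G.weight_eq_prod, Finset.prod_pow_eq_pow_sum, Finset.prod_pow_eq_pow_sum, ← hy]
    calc (x.1 : ℝ) ^ γ * p ^ y ≤ (2 ^ n * (y : ℝ)) ^ γ * p ^ y := by gcongr
      _ = (2 ^ n : ℝ) ^ γ * ((y : ℝ) ^ γ * p ^ y) := by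
          rw [Real.mul_rpow (by positivity) (by positivity)]; ring
      _ ≤ (2 ^ n : ℝ) ^ γ * ((2 * γ * modeNumber p) ^ γ * q ^ y) := by
          exact mul_le_mul_of_nonneg_left (rpow_mul_pow_le hγ hp hp' y) (by positivity)
      _ = K * q ^ y := by rw [hK]; ring
  have hs' := (hs.comp_injective G.leafMomentum_injective).mul_left K
  have hsum := Summable.of_nonneg_of_le
    (fun x => mul_nonneg (Real.rpow_nonneg (Nat.cast_nonneg _) _) (G.weight_nonneg hp.le _ _))
    hle hs'
  refine ⟨hsum, (hsum.tsum_le_tsum hle hs').trans ?_⟩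
  rw [tsum_mul_left]
  refine mul_le_mul_of_nonneg_left ?_ hK0
  refine (tsum_comp_le_tsum_of_inj hs (fun x => Finset.prod_nonneg fun _ _ => pow_nonneg hq0 _)
    G.leafMomentum_injective).trans (ht.trans ?_)
  rw [hqN, Fintype.card_coe]
  exact pow_le_pow_right₀ (by linarith) G.card_leaves_le

theorem amplitude_nonneg (G : FeynmanGraph n) {p : ℝ} (hp : 0 ≤ p) (hp' : p < 1) (r : ℕ) :
    0 ≤ G.amplitude p r :=
  mul_nonneg (one_div_nonneg.2 (pow_nonneg (modeNumber_pos hp').le _))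
    (tsum_nonneg fun _ => G.weight_nonneg hp _ _)

theorem summable_rpow_mul_amplitude (G : FeynmanGraph n) {γ p : ℝ} (hγ : 0 < γ) (hp : 0 < p)
    (hp' : p < 1) :
    Summable (fun r : ℕ => (r : ℝ) ^ γ / modeNumber p * G.amplitude p r) ∧
      ∑' r : ℕ, (r : ℝ) ^ γ / modeNumber p * G.amplitude p r =
        1 / modeNumber p ^ (n + 1) *
          ∑' x : Σ r : ℕ, {i : Fin n → Fin 4 → ℕ // G.IsMomentum r i},
            (x.1 : ℝ) ^ γ * G.weight p x.1 x.2.1 := by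
  have hN := (modeNumber_pos hp').ne'
  have hs := (G.summable_rpow_mul_weight hγ hp hp').1
  have heq : ∀ r : ℕ, (r : ℝ) ^ γ / modeNumber p * G.amplitude p r =
      1 / modeNumber p ^ (n + 1) *
        ∑' i : {i : Fin n → Fin 4 → ℕ // G.IsMomentum r i}, (r : ℝ) ^ γ * G.weight p r i.1 := by
    intro r
    rw [tsum_mul_left, amplitude, pow_succ]
    field_simp
  simp only [heq]
  refine ⟨hs.sigma.mul_left _, ?_⟩
  rw [tsum_mul_left, hs.tsum_sigma]

theorem tsum_rpow_mul_amplitude_le (G : FeynmanGraph n) {γ p : ℝ} (hγ : 0 < γ) (hp : 0 < p)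
    (hp' : p < 1) :
    ∑' r : ℕ, (r : ℝ) ^ γ / modeNumber p * G.amplitude p r ≤
      2 * (2 * γ) ^ γ * modeNumber p ^ γ * (2 * 2 ^ γ) ^ n := by
  have hN := modeNumber_pos hp'
  rw [(G.summable_rpow_mul_amplitude hγ hp hp').2]
  calc _ ≤ 1 / modeNumber p ^ (n + 1) *
        ((2 ^ n) ^ γ * (2 * γ * modeNumber p) ^ γ * (2 * modeNumber p) ^ (n + 1)) := by
        gcongr
        exact (G.summable_rpow_mul_weight hγ hp hp').2
    _ = _ := by
        have h1 : ((2 : ℝ) ^ n) ^ γ = (2 ^ γ) ^ n := by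
          rw [← Real.rpow_natCast, ← Real.rpow_natCast, ← Real.rpow_mul (by norm_num),
            ← Real.rpow_mul (by norm_num), mul_comm]
        rw [h1, Real.mul_rpow (by positivity) hN.le, mul_pow, mul_pow, pow_succ (2 : ℝ)]
        field_simp

theorem abs_sign_le (G : FeynmanGraph n) : |G.sign| ≤ 1 := by
  refine (Complex.abs_re_le_norm _).trans ?_
  rw [norm_prod]
  refine Finset.prod_le_one (fun _ _ => norm_nonneg _) fun v _ => ?_
  split_ifs <;> simp

end FeynmanGraph

/-- The exponential growth rate of the bound on the coefficient of `t ^ (2 * m)`: the first factor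
comes from the number of melonic graphs, the second one from their amplitudes. -/
noncomputable def growthRate (γ : ℝ) : ℝ := 2 ^ 28 * (2 * 2 ^ γ) ^ 2

theorem growthRate_pos (γ : ℝ) : 0 < growthRate γ := by
  rw [growthRate]
  positivity

open Classical in
/-- The coefficients of the double series, in absolute value, are summable over the root momentum,
and their sums grow at most exponentially with the order, uniformly in `p` after division by
`N ^ γ`. -/
theorem summable_melonicG2Coeff {γ p : ℝ} (hγ : 0 < γ) (hp : 0 < p) (hp' : p < 1) (m : ℕ) :
    Summable (fun r : ℕ => |(r : ℝ) ^ γ / modeNumber p * melonicG2Coeff p r m|) ∧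
      ∑' r : ℕ, |(r : ℝ) ^ γ / modeNumber p * melonicG2Coeff p r m| ≤
        4 * (2 * γ) ^ γ * modeNumber p ^ γ * growthRate γ ^ m := by
  have hN := modeNumber_pos hp'
  set s := (Finset.univ : Finset (FeynmanGraph (2 * m))).filter fun G => G.IsMelonic with hs
  set B : ℕ → ℝ := fun r => 1 / ((2 * m).factorial : ℝ) *
    ∑ G ∈ s, (r : ℝ) ^ γ / modeNumber p * G.amplitude p r with hB
  have hle : ∀ r : ℕ, |(r : ℝ) ^ γ / modeNumber p * melonicG2Coeff p r m| ≤ B r := by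
    intro r
    rw [melonicG2Coeff, ← hs, abs_mul, abs_mul, hB]
    have h1 : |(r : ℝ) ^ γ / modeNumber p| = (r : ℝ) ^ γ / modeNumber p :=
      abs_of_nonneg (by positivity)
    have h2 : |1 / ((2 * m).factorial : ℝ) * (1 / 8 ^ m)| ≤ 1 / ((2 * m).factorial : ℝ) := by
      rw [abs_of_nonneg (by positivity)]
      refine mul_le_of_le_one_right (by positivity) ?_
      rw [div_le_one (by positivity)]
      exact one_le_pow₀ (by norm_num)
    have h3 : |∑ G ∈ s, G.sign * G.amplitude p r| ≤ ∑ G ∈ s, G.amplitude p r := by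
      refine (Finset.abs_sum_le_sum_abs _ _).trans (Finset.sum_le_sum fun G _ => ?_)
      rw [abs_mul, abs_of_nonneg (G.amplitude_nonneg hp.le hp' r)]
      exact mul_le_of_le_one_left (G.amplitude_nonneg hp.le hp' r) G.abs_sign_le
    rw [h1]
    beta_reduce
    rw [← Finset.mul_sum]
    calc _ ≤ (r : ℝ) ^ γ / modeNumber p *
          (1 / ((2 * m).factorial : ℝ) * ∑ G ∈ s, G.amplitude p r) := by gcongr
      _ = _ := by ring
  have hsum : ∀ G ∈ s, Summable fun r : ℕ => (r : ℝ) ^ γ / modeNumber p * G.amplitude p r :=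
    fun G _ => (G.summable_rpow_mul_amplitude hγ hp hp').1
  have hBs : Summable B := (summable_sum hsum).mul_left _
  have habs := Summable.of_nonneg_of_le (fun r => abs_nonneg _) hle hBs
  refine ⟨habs, (habs.tsum_le_tsum hle hBs).trans ?_⟩
  rw [hB, tsum_mul_left, Summable.tsum_finsetSum hsum]
  calc _ ≤ 1 / ((2 * m).factorial : ℝ) *
        ∑ G ∈ s, 2 * (2 * γ) ^ γ * modeNumber p ^ γ * (2 * 2 ^ γ) ^ (2 * m) := by
        gcongr with G _
        exact G.tsum_rpow_mul_amplitude_le hγ hp hp'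
    _ = 1 / ((2 * m).factorial : ℝ) *
        ((s.card : ℝ) * (2 * (2 * γ) ^ γ * modeNumber p ^ γ * (2 * 2 ^ γ) ^ (2 * m))) := by
        rw [Finset.sum_const, nsmul_eq_mul]
    _ ≤ 1 / ((2 * m).factorial : ℝ) *
        ((2 * (2 ^ 28) ^ m * ((2 * m).factorial : ℝ)) *
          (2 * (2 * γ) ^ γ * modeNumber p ^ γ * (2 * 2 ^ γ) ^ (2 * m))) := by
        gcongr
        exact card_isMelonic_le_factorial m
    _ = _ := by
        rw [growthRate, mul_pow ((2 : ℝ) ^ 28), ← pow_mul (2 * (2 : ℝ) ^ γ)]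
        have : ((2 * m).factorial : ℝ) ≠ 0 := by positivity
        field_simp
        ring

/-! ### The melonic graphs of order two -/

/-- The propagator that exchanges `j` with `k` if `x` holds, and complements the image of `j` if `y`
holds and that of `k` if `z` holds. -/
def propagator (x y z : Bool) : Fin 4 → Fin 4 :=
  let j : Fin 4 := if x then (if y then 3 else 2) else (if y then 1 else 0)
  let k : Fin 4 := if x then (if z then 1 else 0) else (if z then 3 else 2)
  ![j, opp j, k, opp k]

/-- The inverse of `propagator x y z`. -/
def propagatorInv (x y z : Bool) : Fin 4 → Fin 4 :=
  propagator x (if x then z else y) (if x then y else z)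

theorem propagatorInv_propagator : ∀ x y z c, propagatorInv x y z (propagator x y z c) = c := by
  decide

/-- The map `edge` of the graph `orderTwo x y z s`. -/
def orderTwoEdge (x y z s : Bool) : HalfEdge 2 → HalfEdge 2
  | Sum.inl b => if b = s then Sum.inr (0, 0) else Sum.inr (1, propagator x y z 0)
  | Sum.inr (u, c) =>
    if u = 0 then (if c = 0 then Sum.inl s else Sum.inr (1, propagator x y z c))
    else if propagatorInv x y z c = 0 then Sum.inl (!s) else Sum.inr (0, propagatorInv x y z c)

/-- The graph of order two whose first vertex hangs on the side `s` of the root, with the propagator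
given by `x`, `y`, `z` and the internal edges along this propagator. -/
def orderTwo (x y z s : Bool) : FeynmanGraph 2 where
  edge := orderTwoEdge x y z s
  ingoing u := if u = 0 then s else if x then s else !s
  wavy u := if u = 0 then 1 else 0
  prop u := if u = 0 then propagator x y z else propagatorInv x y z
  edge_edge := by revert x y z s; decide
  isOut_edge := by revert x y z s; decide
  heap v := by
    fin_cases v
    · simp [orderTwoEdge, HalfEdge.IsSlotFor]
    · simp only [orderTwoEdge]
      by_cases h : propagatorInv x y z 0 = 0
      · simp [h, HalfEdge.IsSlotFor]
      · simp [h, HalfEdge.IsSlotFor]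
  wavy_wavy := by decide
  wavy_ne := by decide
  prop_prop := by revert x y z; decide
  prop_opp := by revert x y z; decide

theorem fin_two_cases : ∀ u : Fin 2, u = 0 ∨ u = 1 := by decide

theorem isMelonic_orderTwo (x y z s : Bool) : (orderTwo x y z s).IsMelonic := by
  let H : FeynmanGraph 0 :=
    { edge := fun h => match h with
        | Sum.inl b => Sum.inl (!b)
        | Sum.inr (u, _) => u.elim0
      ingoing := fun u => u.elim0
      wavy := fun u => u
      prop := fun u => u.elim0
      edge_edge := by
        rintro (b | ⟨u, c⟩)
        · simp
        · exact u.elim0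
      isOut_edge := by
        rintro (b | ⟨u, c⟩)
        · simp [HalfEdge.isOut]
        · exact u.elim0
      heap := fun u => u.elim0
      wavy_wavy := fun u => u.elim0
      wavy_ne := fun u => u.elim0
      prop_prop := fun u => u.elim0
      prop_opp := fun u => u.elim0 }
  refine FeynmanGraph.IsMelonic.step (H := H) ?_ (FeynmanGraph.IsMelonic.trivial H)
  refine ⟨⟨⟨fun u => u.elim0, fun u => u.elim0⟩, fun {u} => u.elim0⟩, 0, 0, ?_, ?_, ?_, ?_,
    fun u => u.elim0, fun u => u.elim0, fun u => u.elim0⟩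
  · rintro ⟨u, -⟩; exact u.elim0
  · rintro ⟨u, -⟩; exact u.elim0
  · intro c hc
    simp [orderTwo, orderTwoEdge, hc]
  · rintro (b | ⟨u, c⟩)
    · cases b <;> cases s <;>
        simp [H, HalfEdge.relabel, orderTwo, orderTwoEdge, propagatorInv_propagator]
    · exact u.elim0

theorem exists_propagator_eq {f : Fin 4 → Fin 4} (hf : Function.Injective f)
    (hopp : ∀ c, f (opp c) = opp (f c)) : ∃ x y z, f = propagator x y z := by
  have key : ∀ a b : Fin 4, a ≠ b → a ≠ opp b → ∃ x y z, ![a, opp a, b, opp b] = propagator x y z := by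
    decide
  have h1 : f 1 = opp (f 0) := hopp 0
  have h3 : f 3 = opp (f 2) := hopp 2
  obtain ⟨x, y, z, h⟩ := key (f 0) (f 2) (fun h => absurd (hf h) (by decide))
    (fun h => by rw [← h3] at h; exact absurd (hf h) (by decide))
  refine ⟨x, y, z, ?_⟩
  rw [← h, ← h1, ← h3]
  funext c
  fin_cases c <;> rfl

/-- In a melonic graph of order two, the heap-order puts the first vertex at the root with its parent
half-edge external, so that the graph is determined by a propagator and a side of the root. -/
theorem exists_eq_orderTwo {G : FeynmanGraph 2} (hG : G.IsMelonic) :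
    ∃ x y z s, G = orderTwo x y z s := by
  have hw : ∀ u : Fin 2, G.wavy u = if u = 0 then 1 else 0 := by
    have key : ∀ u w : Fin 2, w ≠ u → w = if u = 0 then 1 else 0 := by decide
    exact fun u => key u _ (G.wavy_ne u)
  have hw0 : G.wavy 0 = 1 := hw 0
  have hw1 : G.wavy 1 = 0 := hw 1
  have h10 : ∀ c, G.prop 1 (G.prop 0 c) = c := fun c => by simpa [hw0] using G.prop_prop 0 c
  have h01 : ∀ c, G.prop 0 (G.prop 1 c) = c := fun c => by simpa [hw1] using G.prop_prop 1 c
  -- the internal edges seen from the vertex with the smaller label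
  obtain ⟨a, ha⟩ : ∃ a, ∀ c, c ≠ a → G.edge (Sum.inr (0, c)) = Sum.inr (1, G.prop 0 c) := by
    cases hG with
    | step hred _ =>
      obtain ⟨f, v, a, -, -, hl, -⟩ := hred
      have hv : v = 0 ∨ v = 1 := fin_two_cases v
      rcases hv with rfl | rfl
      · exact ⟨a, fun c hc => by rw [hl c hc, hw0]⟩
      · refine ⟨G.prop 1 a, fun c hc => ?_⟩
        have h := hl (G.prop 0 c) (fun h => hc (by rw [← h, h10]))
        rw [hw1, h10] at h
        rw [← h, G.edge_edge]
  have hheap := G.heap 0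
  -- the vertex with the smaller label hangs at the root
  obtain rfl : a = 0 := by
    by_contra h
    rw [ha 0 (Ne.symm h)] at hheap
    exact absurd hheap.2 (by decide)
  obtain ⟨s, hs⟩ : ∃ s, G.edge (Sum.inr (0, 0)) = Sum.inl s := by
    rcases hx : G.edge (Sum.inr (0, 0)) with b | ⟨u, c⟩
    · exact ⟨b, rfl⟩
    · rw [hx] at hheap
      exact absurd hheap.2 (by simp)
  have hback : ∀ c, c ≠ 0 → G.edge (Sum.inr (1, G.prop 0 c)) = Sum.inr (0, c) := fun c hc => by
    rw [← ha c hc, G.edge_edge]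
  have hext : G.edge (Sum.inl !s) = Sum.inr (1, G.prop 0 0) := by
    have hs' : G.edge (Sum.inl s) = Sum.inr (0, 0) := by rw [← hs, G.edge_edge]
    rcases hx : G.edge (Sum.inl !s) with b | ⟨u, c⟩
    · have hb : b ≠ s := by
        rintro rfl
        rw [← hx, G.edge_edge] at hs'
        simp at hs'
      have hb' : b = !s := by revert hb; cases b <;> cases s <;> simp
      exact absurd (by rw [hx, hb']) (G.edge_ne (Sum.inl !s))
    · have hx' : G.edge (Sum.inr (u, c)) = Sum.inl !s := by rw [← hx, G.edge_edge]
      have hu : u = 0 ∨ u = 1 := fin_two_cases u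
      rcases hu with rfl | rfl
      · by_cases hc : c = 0
        · subst hc; rw [hs] at hx'; simp at hx'
        · rw [ha c hc] at hx'; simp at hx'
      · by_cases hc : G.prop 1 c = 0
        · rw [← hc, h01]
        · have := hback _ hc
          rw [h01, hx'] at this
          simp at this
  have hs' : G.edge (Sum.inl s) = Sum.inr (0, 0) := by rw [← hs, G.edge_edge]
  have hext' : G.edge (Sum.inr (1, G.prop 0 0)) = Sum.inl !s := by rw [← hext, G.edge_edge]
  obtain ⟨x, y, z, hπ⟩ := exists_propagator_eq
    (f := G.prop 0) (fun c d h => by rw [← h10 c, h, h10]) (G.prop_opp 0)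
  have hπ' : G.prop 1 = propagatorInv x y z := by
    funext c
    have := propagatorInv_propagator x y z (G.prop 1 c)
    rwa [← hπ, h01, eq_comm] at this
  have hi0 : G.ingoing 0 = s := by
    have := G.isOut_edge (Sum.inr (0, 0))
    rw [hs] at this
    simpa [HalfEdge.isOut] using this.symm
  have hi1 : G.ingoing 1 = if x then s else !s := by
    have := G.isOut_edge (Sum.inr (1, G.prop 0 0))
    rw [hext', hπ] at this
    revert this
    generalize G.ingoing = g
    cases x <;> cases y <;> simp [HalfEdge.isOut, propagator, opp] <;> cases s <;> simp
  refine ⟨x, y, z, s, FeynmanGraph.ext ?_ ?_ ?_ ?_⟩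
  · funext h
    simp only [orderTwo]
    rcases h with b | ⟨u, c⟩
    · by_cases hb : b = s
      · subst hb; simp [orderTwoEdge, hs']
      · have hb' : b = !s := by revert hb; cases b <;> cases s <;> simp
        subst hb'; simp [orderTwoEdge, hext, hπ]
    · have hu : u = 0 ∨ u = 1 := fin_two_cases u
      rcases hu with rfl | rfl
      · by_cases hc : c = 0
        · subst hc; simp [orderTwoEdge, hs]
        · simp [orderTwoEdge, hc, ha c hc, hπ]
      · have hc' : c = G.prop 0 (G.prop 1 c) := (h01 c).symm
        by_cases hc : G.prop 1 c = 0
        · rw [hc] at hc'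
          rw [hc', hext', ← hc']
          rw [hπ'] at hc
          simp [orderTwoEdge, hc]
        · have h := hback _ hc
          rw [h01] at h
          rw [h]
          rw [hπ'] at hc ⊢
          simp [orderTwoEdge, hc]
  · funext u
    have hu : u = 0 ∨ u = 1 := fin_two_cases u
    rcases hu with rfl | rfl
    · simpa [orderTwo] using hi0
    · simpa [orderTwo] using hi1
  · funext u; exact hw u
  · funext u
    have hu : u = 0 ∨ u = 1 := fin_two_cases u
    rcases hu with rfl | rfl
    · simpa [orderTwo] using hπ
    · simpa [orderTwo] using hπ'

theorem orderTwo_injective : Function.Injective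
    fun q : Bool × Bool × Bool × Bool => orderTwo q.1 q.2.1 q.2.2.1 q.2.2.2 := by
  have key : ∀ x y z x' y' z', propagator x y z = propagator x' y' z' →
      x = x' ∧ y = y' ∧ z = z' := by decide
  rintro ⟨x, y, z, s⟩ ⟨x', y', z', s'⟩ h
  have h1 := congrFun (congrArg FeynmanGraph.prop h) 0
  have h2 := congrFun (congrArg FeynmanGraph.ingoing h) 0
  simp only [orderTwo, if_true] at h1 h2
  obtain ⟨rfl, rfl, rfl⟩ := key _ _ _ _ _ _ h1
  rw [h2]

open Classical in
theorem sum_isMelonic_two (F : FeynmanGraph 2 → ℝ) :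
    ∑ G ∈ (Finset.univ : Finset (FeynmanGraph 2)).filter (fun G => G.IsMelonic), F G =
      ∑ q : Bool × Bool × Bool × Bool, F (orderTwo q.1 q.2.1 q.2.2.1 q.2.2.2) := by
  rw [← Finset.sum_image (f := F) fun a _ b _ h => orderTwo_injective h]
  congr 1
  ext G
  simp only [Finset.mem_filter, Finset.mem_univ, true_and, Finset.mem_image, Prod.exists]
  constructor
  · intro h
    obtain ⟨x, y, z, s, rfl⟩ := exists_eq_orderTwo h
    exact ⟨x, y, z, s, rfl⟩
  · rintro ⟨x, y, z, s, rfl⟩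
    exact isMelonic_orderTwo x y z s

/-- The two vertices have opposite orientations unless the propagator exchanges `j` with `k`. -/
theorem sign_orderTwo (x y z s : Bool) : (orderTwo x y z s).sign = if x then -1 else 1 := by
  simp only [FeynmanGraph.sign, orderTwo, Fin.prod_univ_two]
  cases x <;> cases s <;> simp

/-- The momenta of a resonant vertex, in the order `j`, `S - j`, `k`, `S - k`. -/
abbrev Resonance : Type := {q : Fin 4 → ℕ // q 0 + q 1 = q 2 + q 3}

/-- The momenta of a melonic graph of order two are those of its first vertex, which are only
subject to the resonance condition. -/
def orderTwoMomentum (x y z s : Bool) :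
    (Σ r : ℕ, {i : Fin 2 → Fin 4 → ℕ // (orderTwo x y z s).IsMomentum r i}) ≃ Resonance where
  toFun i := ⟨i.2.1 0, i.2.2.resonance 0⟩
  invFun q := ⟨q.1 0, fun u c => if u = 0 then q.1 c else q.1 (propagatorInv x y z c), by
    obtain ⟨q, hq⟩ := q
    refine ⟨?_, ?_, ?_⟩
    · intro v
      have hv : v = 0 ∨ v = 1 := fin_two_cases v
      rcases hv with rfl | rfl
      · simpa using hq
      · cases x <;> cases y <;> cases z <;> simp [propagatorInv, propagator, opp] <;> omega
    · rintro (b | ⟨u, c⟩)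
      · by_cases hb : b = s <;>
          simp [orderTwo, orderTwoEdge, hb, FeynmanGraph.halfEdgeMomentum,
            propagatorInv_propagator]
      · have hu : u = 0 ∨ u = 1 := fin_two_cases u
        rcases hu with rfl | rfl
        · by_cases hc : c = 0 <;>
            simp [orderTwo, orderTwoEdge, hc, FeynmanGraph.halfEdgeMomentum,
              propagatorInv_propagator]
        · by_cases hc : propagatorInv x y z c = 0 <;>
            simp [orderTwo, orderTwoEdge, hc, FeynmanGraph.halfEdgeMomentum]
    · intro v c
      have hv : v = 0 ∨ v = 1 := fin_two_cases v
      rcases hv with rfl | rfl <;> simp [orderTwo, propagatorInv_propagator]⟩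
  left_inv := by
    rintro ⟨r, i, hi⟩
    have h0 : i 0 0 = r := by
      have := hi.edge (Sum.inr (0, 0))
      simpa [orderTwo, orderTwoEdge, FeynmanGraph.halfEdgeMomentum] using this.symm
    have h1 : (fun u c => if u = 0 then i 0 c else i 0 (propagatorInv x y z c)) = i := by
      funext u c
      have hu : u = 0 ∨ u = 1 := fin_two_cases u
      rcases hu with rfl | rfl
      · simp
      · have := hi.wavy 1 c
        simpa [orderTwo] using this
    subst h0
    exact Sigma.ext rfl (heq_of_eq (Subtype.ext h1))
  right_inv q := by simp

/-- The three dashed edges carry all the momenta of the first vertex but the one at the half-edge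
joined by the propagator to the parent half-edge of the second vertex. -/
theorem weight_orderTwo (x y z s : Bool) (p : ℝ) (q : Resonance) :
    (orderTwo x y z s).weight p (q.1 0) ((orderTwoMomentum x y z s).symm q).2.1 =
      ∏ c, if c = propagatorInv x y z 0 then 1 else p ^ q.1 c := by
  have h : ((orderTwoMomentum x y z s).symm q).2.1 =
    fun u c => if u = 0 then q.1 c else q.1 (propagatorInv x y z c) := rfl
  rw [h, FeynmanGraph.weight, FeynmanGraph.leaves, Finset.prod_filter]
  cases x <;> cases y <;> cases z <;> cases s <;>
  simp [Fintype.prod_sum_type, Fintype.prod_prod_type, Fin.prod_univ_four, HalfEdge.isOut,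
    HalfEdge.IsParent, orderTwo, orderTwoEdge, propagatorInv, propagator, opp,
    FeynmanGraph.halfEdgeMomentum] <;>
  ring

/-! ### Positivity of the coefficient of order two -/

/-- Of two pairs of reals with the same sum, the more spread one has the larger sum of values of a
convex function. -/
theorem convexOn_add_le_add_of_spread {φ : ℝ → ℝ} {s : Set ℝ} (hφ : ConvexOn ℝ s φ) {a b c d : ℝ}
    (ha : a ∈ s) (hb : b ∈ s) (h : a + b = c + d) (hac : a ≤ c) (had : a ≤ d) :
    φ c + φ d ≤ φ a + φ b := by
  rcases eq_or_lt_of_le (show a ≤ b by linarith) with hab | hab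
  · have h1 : c = a := by linarith
    have h2 : d = b := by linarith
    rw [h1, h2]
  · have hba : 0 < b - a := by linarith
    set θ := (c - a) / (b - a) with hθ
    have hθ0 : 0 ≤ θ := div_nonneg (by linarith) hba.le
    have hθ1 : 0 ≤ 1 - θ := by
      rw [sub_nonneg, hθ, div_le_one hba]; linarith
    have hθm : θ * (b - a) = c - a := div_mul_cancel₀ _ hba.ne'
    have h1 := hφ.2 ha hb hθ1 hθ0 (by ring)
    have h2 := hφ.2 ha hb hθ0 hθ1 (by ring)
    simp only [smul_eq_mul] at h1 h2
    have e1 : (1 - θ) * a + θ * b = c := by linarith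
    have e2 : θ * a + (1 - θ) * b = d := by linarith
    rw [e1] at h1
    rw [e2] at h2
    linarith

theorem rpow_add_le_of_spread {γ : ℝ} (hγ : 1 ≤ γ) {a b c d : ℝ} (ha : 0 ≤ a) (hb : 0 ≤ b)
    (h : a + b = c + d) (hac : a ≤ c) (had : a ≤ d) : c ^ γ + d ^ γ ≤ a ^ γ + b ^ γ :=
  convexOn_add_le_add_of_spread (φ := fun x => x ^ γ) (convexOn_rpow hγ) ha hb h hac had

/-- The gain of `x ^ γ` when the pair `(3/4, 5/4)` is spread to `(1/2, 3/2)`. -/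
noncomputable def spreadGain (γ : ℝ) : ℝ :=
  (1 / 2) ^ γ + (3 / 2) ^ γ - (3 / 4) ^ γ - (5 / 4) ^ γ

theorem spreadGain_pos {γ : ℝ} (hγ : 1 < γ) : 0 < spreadGain γ := by
  have h := (strictConvexOn_rpow hγ).2 (x := 1 / 2) (y := 3 / 2) (by simp) (by simp; norm_num)
    (by norm_num)
  have h1 := h (a := 3 / 4) (b := 1 / 4) (by norm_num) (by norm_num) (by norm_num)
  have h2 := h (a := 1 / 4) (b := 3 / 4) (by norm_num) (by norm_num) (by norm_num)
  simp only [smul_eq_mul] at h1 h2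
  rw [show (3 / 4 : ℝ) * (1 / 2) + 1 / 4 * (3 / 2) = 3 / 4 by norm_num] at h1
  rw [show (1 / 4 : ℝ) * (1 / 2) + 3 / 4 * (3 / 2) = 5 / 4 by norm_num] at h2
  rw [spreadGain]
  linarith

/-- Both pairs are compared with the reference pairs `(s / 2, 3 s / 2)` and `(3 s / 4, 5 s / 4)`. -/
theorem mul_spreadGain_le {γ : ℝ} (hγ : 1 ≤ γ) {s a b c d : ℝ} (hab : a + b = 2 * s)
    (hcd : c + d = 2 * s) (ha : 0 ≤ a) (has : 2 * a ≤ s) (hc : 3 * s ≤ 4 * c) (hcs : c ≤ s) :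
    s ^ γ * spreadGain γ ≤ a ^ γ + b ^ γ - c ^ γ - d ^ γ := by
  have hs : 0 ≤ s := by linarith
  have h1 := rpow_add_le_of_spread hγ ha (b := b) (c := s * (1 / 2)) (d := s * (3 / 2)) (by linarith)
    (by linarith) (by linarith) (by linarith)
  have h2 := rpow_add_le_of_spread hγ (a := s * (3 / 4)) (b := s * (5 / 4)) (c := c) (d := d)
    (by linarith) (by linarith) (by linarith) (by linarith) (by linarith)
  rw [Real.mul_rpow hs (by norm_num), Real.mul_rpow hs (by norm_num)] at h1 h2
  rw [spreadGain]
  linarith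

theorem pow_add_pow_sub {p : ℝ} {a b c d : ℕ} (h : a + b = c + d) (hac : a ≤ c) (had : a ≤ d) :
    p ^ a + p ^ b - p ^ c - p ^ d = p ^ a * ((1 - p ^ (c - a)) * (1 - p ^ (d - a))) := by
  obtain ⟨x, rfl⟩ := Nat.exists_eq_add_of_le hac
  obtain ⟨y, rfl⟩ := Nat.exists_eq_add_of_le had
  obtain rfl : b = a + x + y := by omega
  simp only [Nat.add_sub_cancel_left, pow_add]
  ring

theorem mul_nonneg_of_spread {γ p : ℝ} (hγ : 1 ≤ γ) (hp : 0 ≤ p) (hp' : p ≤ 1) {a b c d : ℕ}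
    (h : a + b = c + d) (hac : a ≤ c) (had : a ≤ d) :
    0 ≤ ((a : ℝ) ^ γ + (b : ℝ) ^ γ - (c : ℝ) ^ γ - (d : ℝ) ^ γ) *
      (p ^ a + p ^ b - p ^ c - p ^ d) := by
  refine mul_nonneg ?_ ?_
  · have := rpow_add_le_of_spread hγ (Nat.cast_nonneg (α := ℝ) a) (Nat.cast_nonneg (α := ℝ) b)
      (c := c) (d := d) (by exact_mod_cast h) (by exact_mod_cast hac) (by exact_mod_cast had)
    linarith
  · rw [pow_add_pow_sub h hac had]
    have h1 : p ^ (c - a) ≤ 1 := pow_le_one₀ hp hp'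
    have h2 : p ^ (d - a) ≤ 1 := pow_le_one₀ hp hp'
    have := pow_nonneg hp a
    exact mul_nonneg this (mul_nonneg (by linarith) (by linarith))

/-- The momenta of a resonance spread in the same way for `x ^ γ` and for `p ^ x`. -/
theorem Resonance.mul_nonneg {γ p : ℝ} (hγ : 1 ≤ γ) (hp : 0 ≤ p) (hp' : p ≤ 1) (q : Resonance) :
    0 ≤ ((q.1 0 : ℝ) ^ γ + (q.1 1 : ℝ) ^ γ - (q.1 2 : ℝ) ^ γ - (q.1 3 : ℝ) ^ γ) *
      (p ^ q.1 0 + p ^ q.1 1 - p ^ q.1 2 - p ^ q.1 3) := by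
  have h := q.2
  rcases le_total (q.1 0) (q.1 1) with h01 | h01 <;> rcases le_total (q.1 2) (q.1 3) with h23 | h23
  · rcases le_total (q.1 0) (q.1 2) with h02 | h02
    · exact mul_nonneg_of_spread hγ hp hp' h h02 (by omega)
    · have := mul_nonneg_of_spread hγ hp hp' h.symm h02 (by omega)
      linarith
  · rcases le_total (q.1 0) (q.1 3) with h02 | h02
    · exact mul_nonneg_of_spread hγ hp hp' h (by omega) h02
    · have := mul_nonneg_of_spread hγ hp hp' (a := q.1 3) (b := q.1 2) (c := q.1 0) (d := q.1 1)
        (by omega) h02 (by omega)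
      linarith
  · rcases le_total (q.1 1) (q.1 2) with h02 | h02
    · have := mul_nonneg_of_spread hγ hp hp' (a := q.1 1) (b := q.1 0) (c := q.1 2) (d := q.1 3)
        (by omega) h02 (by omega)
      linarith
    · have := mul_nonneg_of_spread hγ hp hp' (a := q.1 2) (b := q.1 3) (c := q.1 0) (d := q.1 1)
        (by omega) (by omega) h02
      linarith
  · rcases le_total (q.1 1) (q.1 3) with h02 | h02
    · have := mul_nonneg_of_spread hγ hp hp' (a := q.1 1) (b := q.1 0) (c := q.1 2) (d := q.1 3)
        (by omega) (by omega) h02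
      linarith
    · have := mul_nonneg_of_spread hγ hp hp' (a := q.1 3) (b := q.1 2) (c := q.1 0) (d := q.1 1)
        (by omega) (by omega) h02
      linarith

/-- The weight of a resonance in a graph of order two whose dashed edges carry all of its momenta
but `q e`. -/
noncomputable def resonanceWeight (p : ℝ) (e : Fin 4) (q : Resonance) : ℝ :=
  ∏ c, if c = e then 1 else p ^ q.1 c

/-- The sum of the weights of the four kinds of graphs of order two, with their signs. -/
noncomputable def signedWeight (p : ℝ) (q : Resonance) : ℝ :=
  resonanceWeight p 0 q + resonanceWeight p 1 q - resonanceWeight p 2 q - resonanceWeight p 3 q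

theorem signedWeight_eq (p : ℝ) (q : Resonance) :
    signedWeight p q =
      p ^ (q.1 0 + q.1 1) * (p ^ q.1 0 + p ^ q.1 1 - p ^ q.1 2 - p ^ q.1 3) := by
  have h : p ^ q.1 0 * p ^ q.1 1 = p ^ q.1 2 * p ^ q.1 3 := by
    rw [← pow_add, ← pow_add, q.2]
  simp only [signedWeight, resonanceWeight, Fin.prod_univ_four, pow_add]
  simp only [if_true, show (0 : Fin 4) ≠ 1 by decide, show (0 : Fin 4) ≠ 2 by decide,
    show (0 : Fin 4) ≠ 3 by decide, show (1 : Fin 4) ≠ 0 by decide, show (1 : Fin 4) ≠ 2 by decide,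
    show (1 : Fin 4) ≠ 3 by decide, show (2 : Fin 4) ≠ 0 by decide, show (2 : Fin 4) ≠ 1 by decide,
    show (2 : Fin 4) ≠ 3 by decide, show (3 : Fin 4) ≠ 0 by decide, show (3 : Fin 4) ≠ 1 by decide,
    show (3 : Fin 4) ≠ 2 by decide, if_false]
  linear_combination -(p ^ q.1 0 + p ^ q.1 1) * h

theorem summable_resonanceWeight {γ p : ℝ} (hγ : 0 < γ) (hp : 0 < p) (hp' : p < 1)
    (x y z s : Bool) :
    Summable (fun q : Resonance => (q.1 0 : ℝ) ^ γ * resonanceWeight p (propagatorInv x y z 0) q) ∧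
      ∑' r : ℕ, (r : ℝ) ^ γ / modeNumber p * (orderTwo x y z s).amplitude p r =
        1 / modeNumber p ^ 3 *
          ∑' q : Resonance, (q.1 0 : ℝ) ^ γ * resonanceWeight p (propagatorInv x y z 0) q := by
  let g : (Σ r : ℕ, {i : Fin 2 → Fin 4 → ℕ // (orderTwo x y z s).IsMomentum r i}) → ℝ :=
    fun i => (i.1 : ℝ) ^ γ * (orderTwo x y z s).weight p i.1 i.2.1
  have hw : ∀ q : Resonance, (q.1 0 : ℝ) ^ γ * resonanceWeight p (propagatorInv x y z 0) q =
      g ((orderTwoMomentum x y z s).symm q) := by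
    intro q
    rw [resonanceWeight, ← weight_orderTwo x y z s p q]
    rfl
  have hs : Summable g := ((orderTwo x y z s).summable_rpow_mul_weight hγ hp hp').1
  constructor
  · exact ((orderTwoMomentum x y z s).symm.summable_iff.2 hs).congr fun q => (hw q).symm
  · rw [((orderTwo x y z s).summable_rpow_mul_amplitude hγ hp hp').2, tsum_congr hw]
    exact congrArg _ ((orderTwoMomentum x y z s).symm.tsum_eq g).symm

theorem summable_rpow_mul_resonanceWeight {γ p : ℝ} (hγ : 0 < γ) (hp : 0 < p) (hp' : p < 1)
    (e : Fin 4) : Summable fun q : Resonance => (q.1 0 : ℝ) ^ γ * resonanceWeight p e q := by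
  have h : ∀ e : Fin 4, ∃ x y z, propagatorInv x y z 0 = e := by decide
  obtain ⟨x, y, z, rfl⟩ := h e
  exact (summable_resonanceWeight hγ hp hp' x y z true).1

theorem summable_rpow_mul_signedWeight {γ p : ℝ} (hγ : 0 < γ) (hp : 0 < p) (hp' : p < 1) :
    Summable fun q : Resonance => (q.1 0 : ℝ) ^ γ * signedWeight p q := by
  have h := summable_rpow_mul_resonanceWeight hγ hp hp'
  refine (((h 0).add (h 1)).sub (h 2) |>.sub (h 3)).congr fun q => ?_
  rw [signedWeight]
  ring

/-- The sixteen graphs of order two come in four kinds of four graphs, according to the momentum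
that is not on a dashed edge. -/
theorem melonicSobolevCoeff_one {γ p : ℝ} (hγ : 0 < γ) (hp : 0 < p) (hp' : p < 1) :
    melonicSobolevCoeff γ p 1 =
      1 / (4 * modeNumber p ^ 3) * ∑' q : Resonance, (q.1 0 : ℝ) ^ γ * signedWeight p q := by
  have h1 : ∀ r : ℕ, (r : ℝ) ^ γ / modeNumber p * melonicG2Coeff p r 1 =
      1 / 16 * ∑ q : Bool × Bool × Bool × Bool,
        (orderTwo q.1 q.2.1 q.2.2.1 q.2.2.2).sign *
          ((r : ℝ) ^ γ / modeNumber p * (orderTwo q.1 q.2.1 q.2.2.1 q.2.2.2).amplitude p r) := by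
    intro r
    rw [melonicG2Coeff]
    have := sum_isMelonic_two fun G => G.sign * G.amplitude p r
    rw [show (2 * 1 : ℕ) = 2 from rfl, this, Finset.mul_sum, Finset.mul_sum, Finset.mul_sum]
    refine Finset.sum_congr rfl fun q _ => ?_
    norm_num [Nat.factorial]
    ring
  have h2 : ∀ q : Bool × Bool × Bool × Bool, Summable fun r : ℕ =>
      (orderTwo q.1 q.2.1 q.2.2.1 q.2.2.2).sign *
        ((r : ℝ) ^ γ / modeNumber p * (orderTwo q.1 q.2.1 q.2.2.1 q.2.2.2).amplitude p r) :=
    fun q => ((FeynmanGraph.summable_rpow_mul_amplitude _ hγ hp hp').1).mul_left _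
  have hs := summable_rpow_mul_resonanceWeight hγ hp hp'
  have h3 : ∑' q : Resonance, (q.1 0 : ℝ) ^ γ * signedWeight p q =
      (∑' q : Resonance, (q.1 0 : ℝ) ^ γ * resonanceWeight p 0 q) +
      (∑' q : Resonance, (q.1 0 : ℝ) ^ γ * resonanceWeight p 1 q) -
      (∑' q : Resonance, (q.1 0 : ℝ) ^ γ * resonanceWeight p 2 q) -
      (∑' q : Resonance, (q.1 0 : ℝ) ^ γ * resonanceWeight p 3 q) := by
    rw [← (hs 0).tsum_add (hs 1), ← ((hs 0).add (hs 1)).tsum_sub (hs 2),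
      ← (((hs 0).add (hs 1)).sub (hs 2)).tsum_sub (hs 3)]
    refine tsum_congr fun q => ?_
    rw [signedWeight]
    ring
  rw [melonicSobolevCoeff]
  simp only [h1]
  rw [tsum_mul_left, Summable.tsum_finsetSum fun q _ => h2 q]
  simp only [tsum_mul_left, (summable_resonanceWeight hγ hp hp' _ _ _ _).2, sign_orderTwo,
    Fintype.sum_prod_type, Fintype.sum_bool]
  simp only [propagatorInv, propagator, opp, if_true, Bool.false_eq_true, if_false,
    Matrix.cons_val_zero]
  rw [h3]
  have hN := (modeNumber_pos hp').ne'
  field_simp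
  ring

/-- A permutation of the momenta of a resonance, by an involution `σ` that respects the resonance
condition. -/
def resonancePerm (σ : Fin 4 → Fin 4) (hσ : ∀ c, σ (σ c) = c)
    (h : ∀ q : Resonance, q.1 (σ 0) + q.1 (σ 1) = q.1 (σ 2) + q.1 (σ 3)) :
    Resonance ≃ Resonance where
  toFun q := ⟨fun c => q.1 (σ c), h q⟩
  invFun q := ⟨fun c => q.1 (σ c), h q⟩
  left_inv q := by simp [hσ]
  right_inv q := by simp [hσ]

/-- Symmetrization over the exchanges of `j` with `S - j`, of `k` with `S - k`, and of `j` with `k`.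
The last one changes the sign of the weight. -/
theorem four_mul_tsum_signedWeight {γ p : ℝ} (hγ : 0 < γ) (hp : 0 < p) (hp' : p < 1) :
    (Summable fun q : Resonance =>
      ((q.1 0 : ℝ) ^ γ + (q.1 1 : ℝ) ^ γ - (q.1 2 : ℝ) ^ γ - (q.1 3 : ℝ) ^ γ) * signedWeight p q) ∧
    4 * ∑' q : Resonance, (q.1 0 : ℝ) ^ γ * signedWeight p q =
      ∑' q : Resonance, ((q.1 0 : ℝ) ^ γ + (q.1 1 : ℝ) ^ γ - (q.1 2 : ℝ) ^ γ - (q.1 3 : ℝ) ^ γ) *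
        signedWeight p q := by
  set g : Resonance → ℝ := fun q => (q.1 0 : ℝ) ^ γ * signedWeight p q with hg
  have hs : Summable g := summable_rpow_mul_signedWeight hγ hp hp'
  let e₁ := resonancePerm ![1, 0, 3, 2] (by decide) fun q => by
    have := q.2; simp; omega
  let e₂ := resonancePerm ![2, 3, 0, 1] (by decide) fun q => by
    have := q.2; simp; omega
  let e₃ := resonancePerm ![3, 2, 1, 0] (by decide) fun q => by
    have := q.2; simp; omega
  have h₁ := e₁.summable_iff.2 hs
  have h₂ := e₂.summable_iff.2 hs
  have h₃ := e₃.summable_iff.2 hs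
  have heq : ∀ q : Resonance, g q + (g ∘ e₁) q + (g ∘ e₂) q + (g ∘ e₃) q =
      ((q.1 0 : ℝ) ^ γ + (q.1 1 : ℝ) ^ γ - (q.1 2 : ℝ) ^ γ - (q.1 3 : ℝ) ^ γ) *
        signedWeight p q := by
    intro q
    have h : (p ^ q.1 0 * p ^ q.1 1 : ℝ) = p ^ q.1 2 * p ^ q.1 3 := by
      rw [← pow_add, ← pow_add, q.2]
    simp only [hg, Function.comp_apply, signedWeight_eq, e₁, e₂, e₃, resonancePerm, Equiv.coe_fn_mk,
      Matrix.cons_val, pow_add]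
    linear_combination ((q.1 2 : ℝ) ^ γ + (q.1 3 : ℝ) ^ γ) *
      (p ^ q.1 0 + p ^ q.1 1 - p ^ q.1 2 - p ^ q.1 3) * h
  have hs4 := ((hs.add h₁).add h₂).add h₃
  refine ⟨hs4.congr heq, ?_⟩
  rw [← tsum_congr heq, ((hs.add h₁).add h₂).tsum_add h₃, (hs.add h₁).tsum_add h₂, hs.tsum_add h₁]
  have t₁ : ∑' q, (g ∘ e₁) q = ∑' q, g q := e₁.tsum_eq g
  have t₂ : ∑' q, (g ∘ e₂) q = ∑' q, g q := e₂.tsum_eq g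
  have t₃ : ∑' q, (g ∘ e₃) q = ∑' q, g q := e₃.tsum_eq g
  rw [t₁, t₂, t₃]
  ring

/-- The constant in the lower bound of the coefficient of order two. -/
noncomputable def growthConstant (γ p₀ : ℝ) : ℝ :=
  1 / 65536 * ((1 / 4) ^ γ * spreadGain γ * (Real.exp (-(3 / p₀)) * (1 - Real.exp (-(1 / 4))) ^ 2))

theorem growthConstant_pos {γ : ℝ} (hγ : 1 < γ) (p₀ : ℝ) : 0 < growthConstant γ p₀ := by
  have h1 := spreadGain_pos hγ
  have h2 : 0 < 1 - Real.exp (-(1 / 4)) := by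
    rw [sub_pos, Real.exp_lt_one_iff]; norm_num
  rw [growthConstant]
  positivity

theorem exp_le_pow {p₀ p : ℝ} (hp₀ : 0 < p₀) (hp : p₀ ≤ p) (hp' : p < 1) {k : ℕ}
    (hk : (k : ℝ) ≤ 3 * modeNumber p) : Real.exp (-(3 / p₀)) ≤ p ^ k := by
  have hp0 : 0 < p := hp₀.trans_le hp
  have h1 := Real.one_sub_inv_le_log_of_pos hp0
  rw [← Real.exp_log (pow_pos hp0 k), Real.exp_le_exp, Real.log_pow]
  have h2 : (k : ℝ) * (1 - p) ≤ 3 := by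
    rw [modeNumber] at hk
    have h3 : 0 < 1 - p := by linarith
    calc (k : ℝ) * (1 - p) ≤ 3 * (1 / (1 - p)) * (1 - p) := by gcongr
      _ = 3 := by field_simp
  have h3 : (k : ℝ) * (1 - p⁻¹) = -((k : ℝ) * (1 - p) / p) := by field_simp; ring
  have h4 : (k : ℝ) * (1 - p) / p ≤ 3 / p₀ := by gcongr
  calc -(3 / p₀) ≤ (k : ℝ) * (1 - p⁻¹) := by rw [h3]; linarith
    _ ≤ _ := by gcongr

theorem pow_le_exp {p : ℝ} (hp : 0 < p) (hp' : p < 1) {k : ℕ} (hk : modeNumber p ≤ 4 * k) :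
    p ^ k ≤ Real.exp (-(1 / 4)) := by
  have h1 : p ≤ Real.exp (-(1 - p)) := by
    have := Real.add_one_le_exp (-(1 - p)); linarith
  have h3 : 0 < 1 - p := by linarith
  have h2 : 1 / 4 ≤ (k : ℝ) * (1 - p) := by
    have h4 : 1 / (1 - p) * (1 - p) ≤ 4 * k * (1 - p) := by
      rw [modeNumber] at hk; gcongr
    have h5 : 1 / (1 - p) * (1 - p) = 1 := by field_simp
    linarith
  calc p ^ k ≤ Real.exp (-(1 - p)) ^ k := by gcongr
    _ = Real.exp (-((k : ℝ) * (1 - p))) := by rw [← Real.exp_nat_mul]; congr 1; ring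
    _ ≤ _ := by gcongr

/-- The coefficient of order two is at least of order `N ^ γ`: all terms of the symmetrized sum are
nonnegative, and those with `S` close to `2 N`, `j` close to `0` and `k` close to `S / 2` are of
the expected size. -/
theorem growthConstant_mul_le {γ p₀ p : ℝ} (hγ : 1 < γ) (hp₀ : 0 < p₀) (hp : p₀ ≤ p)
    (hp' : p < 1) : growthConstant γ p₀ * modeNumber p ^ γ ≤ melonicSobolevCoeff γ p 1 := by
  have hp0 : 0 < p := hp₀.trans_le hp
  have hγ0 : 0 < γ := by linarith
  have hN := modeNumber_pos hp'
  have hN1 := one_le_modeNumber hp0.le hp'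
  obtain ⟨hs, h4⟩ := four_mul_tsum_signedWeight hγ0 hp0 hp'
  set T : Resonance → ℝ := fun q =>
    ((q.1 0 : ℝ) ^ γ + (q.1 1 : ℝ) ^ γ - (q.1 2 : ℝ) ^ γ - (q.1 3 : ℝ) ^ γ) * signedWeight p q
    with hT
  have hT0 : ∀ q, 0 ≤ T q := by
    intro q
    have h := q.mul_nonneg hγ.le hp0.le hp'.le
    have h2 := mul_nonneg (pow_nonneg hp0.le (q.1 0 + q.1 1)) h
    rw [hT]
    simp only [signedWeight_eq]
    linarith
  set M := ⌊modeNumber p⌋₊ with hM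
  have hM1 : 1 ≤ M := Nat.le_floor (by simpa using hN1)
  have hMN : (M : ℝ) ≤ modeNumber p := Nat.floor_le hN.le
  have hNM : modeNumber p ≤ 2 * M := by
    have h := (Nat.lt_floor_add_one (modeNumber p)).le
    rw [← hM] at h
    have h1 : (1 : ℝ) ≤ M := by exact_mod_cast hM1
    linarith
  -- `x`, `y`, `z` measure the distances of `S / 2` to `N`, of `j` to `0` and of `k` to `S / 2`
  let F : Fin (M / 8 + 1) × Fin (M / 8 + 1) × Fin (M / 8 + 1) → Resonance := fun x =>
    ⟨![x.2.1, 2 * (M - x.1) - x.2.1, M - x.1 - x.2.2, M - x.1 + x.2.2], by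
      have h1 := x.1.2
      have h2 := x.2.1.2
      have h3 := x.2.2.2
      simp only [Matrix.cons_val]
      omega⟩
  have hF : Function.Injective F := by
    rintro ⟨x, y, z⟩ ⟨x', y', z'⟩ h
    have h0 := congrFun (congrArg Subtype.val h) 0
    have h2 := congrFun (congrArg Subtype.val h) 2
    have h3 := congrFun (congrArg Subtype.val h) 3
    simp only [F, Matrix.cons_val] at h0 h2 h3
    have := x.2; have := y.2; have := z.2; have := x'.2; have := y'.2; have := z'.2
    simp only [Prod.mk.injEq, Fin.ext_iff]
    omega
  set K := (modeNumber p / 4) ^ γ * spreadGain γ *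
    (Real.exp (-(3 / p₀)) * (1 - Real.exp (-(1 / 4))) ^ 2) with hK
  have hgain := spreadGain_pos hγ
  have hexp : 0 < 1 - Real.exp (-(1 / 4)) := by
    rw [sub_pos, Real.exp_lt_one_iff]; norm_num
  have hterm : ∀ x, K ≤ T (F x) := by
    rintro ⟨x, y, z⟩
    have hx := x.2
    have hy := y.2
    have hz := z.2
    obtain ⟨s, hs⟩ : ∃ s, s = M - x.1 := ⟨_, rfl⟩
    obtain ⟨b, hb⟩ : ∃ b, b = 2 * s - y.1 := ⟨_, rfl⟩
    obtain ⟨c, hc⟩ : ∃ c, c = s - z.1 := ⟨_, rfl⟩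
    have hFx : T (F (x, y, z)) =
        ((y.1 : ℝ) ^ γ + (b : ℝ) ^ γ - (c : ℝ) ^ γ - ((s + z.1 : ℕ) : ℝ) ^ γ) *
          (p ^ (y.1 + b) * (p ^ y.1 + p ^ b - p ^ c - p ^ (s + z.1))) := by
      simp only [hT, F, signedWeight_eq, Matrix.cons_val, ← hs, ← hb, ← hc]
    have hab : y.1 + b = 2 * s := by omega
    have hcd : c + (s + z.1) = 2 * s := by omega
    have hgain' := mul_spreadGain_le hγ.le (s := s) (a := y.1) (b := b) (c := c)
      (d := ((s + z.1 : ℕ) : ℝ)) (by exact_mod_cast hab) (by exact_mod_cast hcd)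
      (Nat.cast_nonneg _) (by exact_mod_cast (by omega : 2 * y.1 ≤ s))
      (by exact_mod_cast (by omega : 3 * s ≤ 4 * c)) (by exact_mod_cast (by omega : c ≤ s))
    have hsN : modeNumber p / 4 ≤ s := by
      have h1 : (M : ℝ) ≤ 2 * s := by exact_mod_cast (by omega : M ≤ 2 * s)
      linarith
    have h1 : (modeNumber p / 4) ^ γ * spreadGain γ ≤
        (y.1 : ℝ) ^ γ + (b : ℝ) ^ γ - (c : ℝ) ^ γ - ((s + z.1 : ℕ) : ℝ) ^ γ := by
      refine le_trans ?_ hgain'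
      gcongr
    have h2 : Real.exp (-(3 / p₀)) ≤ p ^ (y.1 + b + y.1) := by
      refine exp_le_pow hp₀ hp hp' ?_
      have h3 : ((y.1 + b + y.1 : ℕ) : ℝ) ≤ 3 * M := by
        exact_mod_cast (by omega : y.1 + b + y.1 ≤ 3 * M)
      linarith
    have h3 : p ^ (c - y.1) ≤ Real.exp (-(1 / 4)) := by
      refine pow_le_exp hp0 hp' ?_
      have h3 : (M : ℝ) ≤ 2 * (c - y.1 : ℕ) := by exact_mod_cast (by omega : M ≤ 2 * (c - y.1))
      linarith
    have h4 : p ^ (s + z.1 - y.1) ≤ Real.exp (-(1 / 4)) := by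
      refine pow_le_exp hp0 hp' ?_
      have h3 : (M : ℝ) ≤ 2 * (s + z.1 - y.1 : ℕ) := by
        exact_mod_cast (by omega : M ≤ 2 * (s + z.1 - y.1))
      linarith
    rw [hFx, pow_add_pow_sub (by omega) (by omega) (by omega), ← mul_assoc (p ^ (y.1 + b)),
      ← pow_add, hK, pow_two]
    gcongr
    · exact le_trans (by positivity) h1
    · linarith
  have hlow : ((M / 8 + 1 : ℕ) : ℝ) ^ 3 * K ≤ ∑' q, T q := by
    refine le_trans ?_ (tsum_comp_le_tsum_of_inj hs hT0 hF)
    rw [tsum_fintype]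
    calc ((M / 8 + 1 : ℕ) : ℝ) ^ 3 * K =
        ∑ _x : Fin (M / 8 + 1) × Fin (M / 8 + 1) × Fin (M / 8 + 1), K := by
          simp only [Finset.sum_const, Finset.card_univ, Fintype.card_prod, Fintype.card_fin,
            nsmul_eq_mul]
          push_cast
          ring
      _ ≤ _ := Finset.sum_le_sum fun x _ => hterm x
  have hcount : modeNumber p / 16 ≤ ((M / 8 + 1 : ℕ) : ℝ) := by
    have h1 : (M : ℝ) ≤ 8 * (M / 8 + 1 : ℕ) := by
      exact_mod_cast (by omega : M ≤ 8 * (M / 8 + 1))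
    linarith
  have hK0 : 0 ≤ K := by positivity
  rw [melonicSobolevCoeff_one hγ0 hp0 hp']
  have hsum : (modeNumber p / 16) ^ 3 * K / 4 ≤
      ∑' q : Resonance, (q.1 0 : ℝ) ^ γ * signedWeight p q := by
    have h1 : (modeNumber p / 16) ^ 3 * K ≤ ((M / 8 + 1 : ℕ) : ℝ) ^ 3 * K := by gcongr
    linarith
  calc growthConstant γ p₀ * modeNumber p ^ γ
      = 1 / (4 * modeNumber p ^ 3) * ((modeNumber p / 16) ^ 3 * K / 4) := by
        rw [hK, growthConstant, show modeNumber p / 4 = 1 / 4 * modeNumber p by ring,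
          Real.mul_rpow (by norm_num) hN.le]
        field_simp
        ring
    _ ≤ _ := by gcongr

/-! ### Strict monotonicity -/

theorem pow_succ_sub_pow_succ_le {u v d : ℝ} (hu : 0 ≤ u) (huv : u ≤ v) (hv : v ≤ d) (k : ℕ) :
    v ^ (k + 1) - u ^ (k + 1) ≤ (v - u) * (2 * d) ^ k := by
  have hd : 0 ≤ d := hu.trans (huv.trans hv)
  have key : v ^ (k + 1) - u ^ (k + 1) ≤ (v - u) * ((k + 1 : ℕ) * d ^ k) := by
    induction k with
    | zero => simp
    | succ k ih =>
      have h1 : u ^ (k + 1) ≤ d ^ (k + 1) := by gcongr; exact huv.trans hv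
      have hvu : 0 ≤ v - u := sub_nonneg.2 huv
      have h3 : 0 ≤ v ^ (k + 1) - u ^ (k + 1) :=
        sub_nonneg.2 (pow_le_pow_left₀ hu huv _)
      calc v ^ (k + 1 + 1) - u ^ (k + 1 + 1)
          = v * (v ^ (k + 1) - u ^ (k + 1)) + (v - u) * u ^ (k + 1) := by ring
        _ ≤ d * ((v - u) * ((k + 1 : ℕ) * d ^ k)) + (v - u) * d ^ (k + 1) := by gcongr
        _ = _ := by push_cast; ring
  refine key.trans (mul_le_mul_of_nonneg_left ?_ (sub_nonneg.2 huv))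
  rw [mul_pow]
  gcongr
  exact_mod_cast Nat.lt_two_pow_self

/-- A power series whose coefficients grow at most exponentially is strictly increasing near `0` if
its linear coefficient is positive. -/
theorem tsum_lt_tsum_of_linear_coeff {a : ℕ → ℝ} {B D c d u v : ℝ} (hD : 0 ≤ D)
    (ha : ∀ m, |a m| ≤ B * D ^ m) (ha1 : c ≤ a 1) (hd : 2 * D * d ≤ 1 / 2)
    (hc : 2 * (B * D * (2 * D * d)) < c) (hu : 0 ≤ u) (huv : u < v) (hv : v ≤ d) :
    ∑' m, a m * u ^ m < ∑' m, a m * v ^ m := by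
  have hB : 0 ≤ B := by simpa using (abs_nonneg _).trans (ha 0)
  have hd0 : 0 ≤ d := hu.trans (huv.le.trans hv)
  have hsum : ∀ w, 0 ≤ w → w ≤ d → Summable fun m => a m * w ^ m := by
    intro w hw hwd
    have h1 : D * w < 1 := by
      have : D * w ≤ D * d := by gcongr
      linarith
    refine Summable.of_norm_bounded
      ((summable_geometric_of_lt_one (mul_nonneg hD hw) h1).mul_left B) fun m => ?_
    rw [Real.norm_eq_abs, abs_mul, abs_of_nonneg (pow_nonneg hw m), mul_pow, ← mul_assoc]
    gcongr
    exact ha m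
  have hsu := hsum u hu (huv.le.trans hv)
  have hsv := hsum v (hu.trans huv.le) hv
  rw [← sub_pos, ← hsv.tsum_sub hsu]
  have hs := hsv.sub hsu
  rw [← hs.sum_add_tsum_nat_add 2]
  set ρ := 2 * D * d with hρ
  have hρ0 : 0 ≤ ρ := by positivity
  have hvu : 0 < v - u := sub_pos.2 huv
  have htail : |∑' m, (a (m + 2) * v ^ (m + 2) - a (m + 2) * u ^ (m + 2))| ≤
      (v - u) * (B * D * ρ) * (1 - ρ)⁻¹ := by
    rw [← Real.norm_eq_abs]
    refine tsum_of_norm_bounded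
      ((hasSum_geometric_of_lt_one hρ0 (by linarith)).mul_left ((v - u) * (B * D * ρ))) fun m => ?_
    have h1 : 0 ≤ v ^ (m + 2) - u ^ (m + 2) := sub_nonneg.2 (pow_le_pow_left₀ hu huv.le _)
    rw [← mul_sub, Real.norm_eq_abs, abs_mul, abs_of_nonneg h1]
    calc |a (m + 2)| * (v ^ (m + 2) - u ^ (m + 2))
        ≤ (B * D ^ (m + 2)) * ((v - u) * (2 * d) ^ (m + 1)) := by
          gcongr
          · exact ha _
          · exact pow_succ_sub_pow_succ_le hu huv.le hv (m + 1)
      _ = (v - u) * (B * D * ρ) * ρ ^ m := by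
          have : (D : ℝ) ^ (m + 2) * (2 * d) ^ (m + 1) = D * (ρ * ρ ^ m) := by
            rw [← pow_succ', hρ, pow_succ D (m + 1), show 2 * D * d = D * (2 * d) by ring, mul_pow D]
            ring
          linear_combination (B * (v - u)) * this
  have hinv : (1 - ρ)⁻¹ ≤ 2 := by
    rw [inv_le_comm₀ (by linarith) (by norm_num)]; linarith
  have htail' : (v - u) * (B * D * ρ) * (1 - ρ)⁻¹ ≤ (v - u) * (B * D * ρ) * 2 := by gcongr
  have hlin : (v - u) * c ≤ (v - u) * a 1 := by gcongr
  have hstrict : (v - u) * (2 * (B * D * ρ)) < (v - u) * c := by gcongr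
  have := (abs_le.1 htail).1
  simp only [Finset.sum_range_succ, Finset.sum_range_zero, pow_zero, pow_one]
  linarith

theorem abs_melonicSobolevCoeff_le {γ p : ℝ} (hγ : 0 < γ) (hp : 0 < p) (hp' : p < 1) (m : ℕ) :
    |melonicSobolevCoeff γ p m| ≤
      4 * (2 * γ) ^ γ * modeNumber p ^ γ * growthRate γ ^ m := by
  obtain ⟨hs, hle⟩ := summable_melonicG2Coeff hγ hp hp' m
  refine le_trans ?_ hle
  have h := norm_tsum_le_tsum_norm
    (f := fun r : ℕ => (r : ℝ) ^ γ / modeNumber p * melonicG2Coeff p r m) hs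
  simp only [Real.norm_eq_abs] at h
  exact h

theorem summable_mul_pow_of_tsum_abs_le {a : ℕ → ℕ → ℝ} {B D t : ℝ}
    (hs : ∀ m, Summable fun r => |a r m|) (ha : ∀ m, ∑' r, |a r m| ≤ B * D ^ m) (hD : 0 ≤ D)
    (ht : D * t ^ 2 < 1) : Summable fun x : ℕ × ℕ => a x.1 x.2 * t ^ (2 * x.2) := by
  let F : ℕ × ℕ → ℝ := fun x => |a x.2 x.1| * t ^ (2 * x.1)
  have ht0 : ∀ m, 0 ≤ t ^ (2 * m) := fun m => by rw [pow_mul]; positivity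
  have hFs : Summable F := by
    rw [summable_prod_of_nonneg fun x => mul_nonneg (abs_nonneg _) (ht0 _)]
    refine ⟨fun m => (hs m).mul_right (t ^ (2 * m)), ?_⟩
    refine Summable.of_nonneg_of_le
      (fun m => tsum_nonneg fun r => mul_nonneg (abs_nonneg _) (ht0 _)) (fun m => ?_)
      ((summable_geometric_of_lt_one (mul_nonneg hD (sq_nonneg t)) ht).mul_left B)
    change ∑' r, |a r m| * t ^ (2 * m) ≤ _
    rw [tsum_mul_right, mul_pow D, ← pow_mul t, ← mul_assoc]
    exact mul_le_mul_of_nonneg_right (ha m) (ht0 m)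
  refine Summable.of_norm_bounded hFs.prod_symm fun x => ?_
  rw [Real.norm_eq_abs, abs_mul, abs_of_nonneg (ht0 x.2)]
  exact le_rfl

end MelonicTurbulence

theorem theorem2 (γ : ℝ) (hγ : 1 < γ) (p₀ : ℝ) (hp₀ : 0 < p₀) (hp₀' : p₀ < 1) :
    ∃ δ : ℝ, 0 < δ ∧ ∀ p : ℝ, p₀ ≤ p → p < 1 →
      -- the sums over momenta in the amplitudes converge
      (∀ (n : ℕ) (G : MelonicTurbulence.FeynmanGraph n), G.IsMelonic → ∀ r : ℕ,
        Summable fun i : {i : Fin n → Fin 4 → ℕ // G.IsMomentum r i} => G.weight p r i.1) ∧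
      -- the double series over the root momentum `r` and the order `2 * m` converges absolutely
      (∀ t ∈ Set.Icc (0 : ℝ) δ, Summable fun x : ℕ × ℕ =>
        (x.1 : ℝ) ^ γ / MelonicTurbulence.modeNumber p *
          MelonicTurbulence.melonicG2Coeff p x.1 x.2 * t ^ (2 * x.2)) ∧
      StrictMonoOn (MelonicTurbulence.melonicSobolevNorm γ p) (Set.Icc 0 δ) := by
  have hγ0 : 0 < γ := by linarith
  set D : ℝ := MelonicTurbulence.growthRate γ with hD
  set A : ℝ := 4 * (2 * γ) ^ γ with hA
  set c : ℝ := MelonicTurbulence.growthConstant γ p₀ with hc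
  have hD0 : 0 < D := MelonicTurbulence.growthRate_pos γ
  have hA0 : 0 < A := by positivity
  have hc0 : 0 < c := MelonicTurbulence.growthConstant_pos hγ p₀
  -- the ratio of the geometric series that bounds the terms of order greater than two
  set ρ : ℝ := min (1 / 2) (c / (4 * (A * D))) with hρ
  have hρ0 : 0 < ρ := by positivity
  have hρ1 : ρ ≤ 1 / 2 := min_le_left _ _
  have hρ2 : 2 * (A * D * ρ) < c := by
    have h1 : ρ * (4 * (A * D)) ≤ c := (le_div_iff₀ (by positivity)).1 (min_le_right _ _)
    linarith
  have hd0 : 0 < ρ / (2 * D) := by positivity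
  have hρd : 2 * D * (ρ / (2 * D)) = ρ := by field_simp
  have hsq : ∀ t ∈ Set.Icc (0 : ℝ) (Real.sqrt (ρ / (2 * D))), t ^ 2 ≤ ρ / (2 * D) := fun t ht => by
    rw [← Real.sq_sqrt hd0.le]
    exact pow_le_pow_left₀ ht.1 ht.2 2
  refine ⟨Real.sqrt (ρ / (2 * D)), Real.sqrt_pos.2 hd0, fun p hp hp' => ?_⟩
  have hp0 : 0 < p := hp₀.trans_le hp
  have hN := MelonicTurbulence.modeNumber_pos hp'
  refine ⟨fun n G _ r => G.summable_weight hp0.le hp' r, fun t ht => ?_, ?_⟩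
  · have h1 : D * t ^ 2 ≤ D * (ρ / (2 * D)) := mul_le_mul_of_nonneg_left (hsq t ht) hD0.le
    have h2 : D * t ^ 2 < 1 := by linarith
    exact MelonicTurbulence.summable_mul_pow_of_tsum_abs_le
      (a := fun r m => (r : ℝ) ^ γ / MelonicTurbulence.modeNumber p *
        MelonicTurbulence.melonicG2Coeff p r m)
      (fun m => (MelonicTurbulence.summable_melonicG2Coeff hγ0 hp0 hp' m).1)
      (fun m => (MelonicTurbulence.summable_melonicG2Coeff hγ0 hp0 hp' m).2) hD0.le h2
  · intro x hx y hy hxy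
    simp only [MelonicTurbulence.melonicSobolevNorm, pow_mul]
    refine MelonicTurbulence.tsum_lt_tsum_of_linear_coeff hD0.le
      (MelonicTurbulence.abs_melonicSobolevCoeff_le hγ0 hp0 hp')
      (MelonicTurbulence.growthConstant_mul_le hγ hp₀ hp hp') (d := ρ / (2 * D)) ?_ ?_ (by positivity)
      (pow_lt_pow_left₀ hxy hx.1 (by norm_num)) (hsq y hy)
    · rw [hρd]; exact hρ1
    · rw [hρd]
      have h1 : 0 < MelonicTurbulence.modeNumber p ^ γ := Real.rpow_pos_of_pos hN γ
      calc 2 * (A * MelonicTurbulence.modeNumber p ^ γ * D * ρ)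
          = 2 * (A * D * ρ) * MelonicTurbulence.modeNumber p ^ γ := by ring
        _ < c * MelonicTurbulence.modeNumber p ^ γ := by gcongr
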